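/- For structures $M,N$ in a first-order language, finite tuples $\vec a\in M^n$, $\vec b\in N^n$ and an ordinal $\alpha$, define the standard symmetric back-and-forth relation $(M,\vec a)\equiv^{\mathrm{bf}}_\alpha(N,\vec b)$ by recursion: for $\alpha=0$ it means that $\vec a$ and $\vec b$ satisfy the same quantifier-free formulas; for $\alpha>0$ it means that for every $\beta<\alpha$ and every finite tuple $\vec c$ from $M$ (of arbitrary length) there is a tuple $\vec d$ from $N$ of the same length with $(M,\vec a\vec c)\equiv^{\mathrm{bf}}_\beta(N,\vec b\vec d)$, and for every $\beta<\alpha$ and every finite tuple $\vec d$ from $N$ there is a tuple $\vec c$ from $M$ of the same length with $(M,\vec a\vec c)\equiv^{\mathrm{bf}}_\beta(N,\vec b\vec d)$. Write $M\equiv^{\mathrm{bf}}_\alpha N$ if this holds for the empty tuples. For a (discrete) group $G$, let $L(G)$ be its group von Neumann algebra, the closure in the strong operator topology of the image of $\mathbb C[G]$ in $\mathcal B(\ell^2(G))$ under the left regular representation, with the trace $\operatorname{tr}(x)=\langle x\delta_e,\delta_e\rangle$ and $\|x\|_2=\sqrt{\operatorname{tr}(x^*x)}$. It is viewed as a many-sorted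 metric structure whose sorts are the operator norm balls of positive integer radius with the metric induced by $\|\cdot\|_2$, and whose symbols are the constants $0,1$, the inclusions between balls, addition, multiplication, scalar multiplication and adjoint restricted to balls, and the real and imaginary parts of the trace. **Corollary.** Let $G$ and $H$ be groups such that $G\equiv^{\mathrm{bf}}_\omega H$ (as structures in the language of groups). Then $L(G)$ and $L(H)$ are elementarily equivalent tracial von Neumann algebras: every sentence $\sigma$ of (finitary) continuous first-order logic in the above language satisfies $\sigma^{L(G)}=\sigma^{L(H)}$. -/

import Mathlib

open scoped NNReal

/-! ## Back-and-forth relations between classical structures -/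

section BackAndForth

/-- The standard symmetric back-and-forth relation `(M, a) ≡ᵇᶠ_α (N, b)`, by recursion on the
ordinal `α`: at rank `0` the tuples have the same quantifier-free type; at rank `α > 0`, for every
`β < α`, each finite tuple (of any length, from either side) has an answer on the other side such
that the extended tuples are related at rank `β`. -/
def BackForth (L : FirstOrder.Language) {M N : Type*} [L.Structure M] [L.Structure N]
    (α : Ordinal) {n : ℕ} (a : Fin n → M) (b : Fin n → N) : Prop :=
  (α = 0 → ∀ φ : L.Formula (Fin n), φ.IsQF → (φ.Realize a ↔ φ.Realize b)) ∧
  (∀ β < α,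
    (∀ (m : ℕ) (c : Fin m → M), ∃ d : Fin m → N,
      BackForth L β (Fin.append a c) (Fin.append b d)) ∧
    (∀ (m : ℕ) (d : Fin m → N), ∃ c : Fin m → M,
      BackForth L β (Fin.append a c) (Fin.append b d)))
termination_by α

/-- `M ≡ᵇᶠ_α N`: the empty tuples are back-and-forth equivalent at rank `α`. -/
def BackForthEquiv (L : FirstOrder.Language) (α : Ordinal) (M N : Type*)
    [L.Structure M] [L.Structure N] : Prop :=
  BackForth L α (Fin.elim0 : Fin 0 → M) (Fin.elim0 : Fin 0 → N)

/-- The function symbols of the language of groups. -/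
inductive GroupFn : ℕ → Type
  | one : GroupFn 0
  | inv : GroupFn 1
  | mul : GroupFn 2

/-- The first-order language of groups. -/
def groupLanguage : FirstOrder.Language where
  Functions := GroupFn
  Relations := fun _ => Empty

/-- A group as a structure in the language of groups. -/
instance groupStructure (G : Type*) [Group G] : groupLanguage.Structure G where
  funMap := fun {_} f x =>
    match f, x with
    | .one, _ => 1
    | .inv, x => (x 0)⁻¹
    | .mul, x => x 0 * x 1
  RelMap := fun r _ => r.elim

end BackAndForth

/-! ## Many-sorted continuous first-order logic -/

namespace ContLogic

/-- A modulus of arity `n`: a non-decreasing, subadditive, continuous function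
`[0,∞)ⁿ → [0,∞)` vanishing at zero. -/
structure Modulus (n : ℕ) where
  toFun : (Fin n → ℝ≥0) → ℝ≥0
  mono : Monotone toFun
  subadd : ∀ x y, toFun (x + y) ≤ toFun x + toFun y
  map_zero : toFun 0 = 0
  cont : Continuous toFun

/-- The modulus `δ ↦ ∑ cᵢ δᵢ`. -/
def Modulus.linear {n : ℕ} (c : Fin n → ℝ≥0) : Modulus n where
  toFun := fun δ => ∑ i, c i * δ i
  mono := fun x y h => Finset.sum_le_sum fun i _ => mul_le_mul_right (h i) (c i)
  subadd := fun x y => by simp [mul_add, Finset.sum_add_distrib]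
  map_zero := by simp
  cont := by fun_prop

theorem Modulus.le_linear_one {a : ℝ≥0} {δ : Fin 1 → ℝ≥0} {r : ℝ} (h : r ≤ (a : ℝ) * δ 0) :
    r ≤ (((Modulus.linear ![a]).toFun δ : ℝ≥0) : ℝ) :=
  h.trans_eq (by simp [Modulus.linear])

theorem Modulus.le_linear_two {a b : ℝ≥0} {δ : Fin 2 → ℝ≥0} {r : ℝ}
    (h : r ≤ (a : ℝ) * δ 0 + (b : ℝ) * δ 1) :
    r ≤ (((Modulus.linear ![a, b]).toFun δ : ℝ≥0) : ℝ) :=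
  h.trans_eq (by simp [Modulus.linear, Fin.sum_univ_two])

/-- A many-sorted metric language. Every sort comes with a bound on the diameter of its
interpretation; function and predicate symbols come with moduli of continuity, and each predicate
symbol with a compact interval `[prLo, prHi]` in which it takes its values. -/
structure MetricLanguage where
  Srt : Type
  diam : Srt → ℝ
  Fn : Type
  fnArity : Fn → ℕ
  fnDom : ∀ f, Fin (fnArity f) → Srt
  fnCod : Fn → Srt
  fnMod : ∀ f, Modulus (fnArity f)
  Pr : Type
  prArity : Pr → ℕ
  prDom : ∀ P, Fin (prArity P) → Srt
  prMod : ∀ P, Modulus (prArity P)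
  prLo : Pr → ℝ
  prHi : Pr → ℝ

/-- A metric structure: nonempty complete metric spaces of bounded diameter as sorts, with
operations and predicates obeying the prescribed moduli and bounds. -/
structure MetricStructure (L : MetricLanguage) where
  carrier : L.Srt → Type*
  [metric : ∀ s, MetricSpace (carrier s)]
  [nonempty : ∀ s, Nonempty (carrier s)]
  [complete : ∀ s, CompleteSpace (carrier s)]
  dist_le : ∀ s (x y : carrier s), dist x y ≤ L.diam s
  fn : ∀ f, (∀ i, carrier (L.fnDom f i)) → carrier (L.fnCod f)
  fn_obeys : ∀ f x y, dist (fn f x) (fn f y) ≤ (L.fnMod f).toFun fun i => nndist (x i) (y i)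
  pr : ∀ P, (∀ i, carrier (L.prDom P i)) → ℝ
  pr_mem : ∀ P x, pr P x ∈ Set.Icc (L.prLo P) (L.prHi P)
  pr_obeys : ∀ P x y, |pr P x - pr P y| ≤ (L.prMod P).toFun fun i => nndist (x i) (y i)

attribute [instance] MetricStructure.metric MetricStructure.nonempty MetricStructure.complete

/-- `Ext V s` extends the family of variables `V` (indexed by sorts) by one new variable of
sort `s`. -/
inductive Ext {S : Type} (V : S → Type) (s : S) : S → Type
  | old {t : S} (x : V t) : Ext V s t
  | new : Ext V s s

/-- Terms with free variables among `V`, indexed by their sort. -/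
inductive Term (L : MetricLanguage) (V : L.Srt → Type) : L.Srt → Type
  | var {s : L.Srt} (x : V s) : Term L V s
  | app (f : L.Fn) (ts : ∀ i, Term L V (L.fnDom f i)) : Term L V (L.fnCod f)

/-- Formulas of (finitary) continuous logic with free variables among `V`: atomic formulas are
distances between terms and predicates applied to terms; connectives are continuous functions
`ℝⁿ → ℝ`; quantifiers are `sup` and `inf` over a sort. -/
inductive Formula (L : MetricLanguage) : (L.Srt → Type) → Type 1
  | dist {V : L.Srt → Type} {s : L.Srt} (t₁ t₂ : Term L V s) : Formula L V
  | pred {V : L.Srt → Type} (P : L.Pr) (ts : ∀ i, Term L V (L.prDom P i)) : Formula L V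
  | conn {V : L.Srt → Type} {n : ℕ} (u : C(Fin n → ℝ, ℝ)) (φ : Fin n → Formula L V) : Formula L V
  | sup {V : L.Srt → Type} (s : L.Srt) (φ : Formula L (Ext V s)) : Formula L V
  | inf {V : L.Srt → Type} (s : L.Srt) (φ : Formula L (Ext V s)) : Formula L V

/-- Sentences: formulas without free variables. -/
abbrev Sentence (L : MetricLanguage) : Type 1 := Formula L fun _ => Empty

variable {L : MetricLanguage}

/-- Extend an assignment by the value `a` for the new variable. -/
def extend (M : MetricStructure L) {V : L.Srt → Type} (v : ∀ s, V s → M.carrier s) {s : L.Srt}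
    (a : M.carrier s) : ∀ t, Ext V s t → M.carrier t
  | _, .old x => v _ x
  | _, .new => a

/-- The value of a term under an assignment. -/
def Term.eval (M : MetricStructure L) {V : L.Srt → Type} (v : ∀ s, V s → M.carrier s) :
    ∀ {s : L.Srt}, Term L V s → M.carrier s
  | _, .var x => v _ x
  | _, .app f ts => M.fn f fun i => (ts i).eval M v

/-- The value `φ^M(v)` of a formula under an assignment. -/
noncomputable def Formula.eval (M : MetricStructure L) : ∀ {V : L.Srt → Type},
    Formula L V → (∀ s, V s → M.carrier s) → ℝ
  | _, .dist t₁ t₂, v => Dist.dist (t₁.eval M v) (t₂.eval M v)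
  | _, .pred P ts, v => M.pr P fun i => (ts i).eval M v
  | _, .conn u φ, v => u fun i => (φ i).eval M v
  | _, .sup s φ, v => ⨆ a : M.carrier s, φ.eval M (extend M v a)
  | _, .inf s φ, v => ⨅ a : M.carrier s, φ.eval M (extend M v a)

/-- The value of a formula is bounded uniformly in the assignment; hence the suprema and infima
in `Formula.eval` are genuine ones. -/
theorem Formula.eval_bounded (M : MetricStructure L) {V : L.Srt → Type} (φ : Formula L V) :
    ∃ C : ℝ, ∀ v, |φ.eval M v| ≤ C := by
  induction φ with
  | @dist V s t₁ t₂ =>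
    refine ⟨L.diam s, fun v => ?_⟩
    rw [Formula.eval, abs_of_nonneg dist_nonneg]
    exact M.dist_le s _ _
  | pred P ts =>
    refine ⟨max |L.prLo P| |L.prHi P|, fun v => ?_⟩
    rw [Formula.eval]
    exact abs_le_max_abs_abs (M.pr_mem P _).1 (M.pr_mem P _).2
  | conn u φ ih =>
    choose C hC using ih
    obtain ⟨B, hB⟩ := (isCompact_univ_pi fun i =>
      isCompact_Icc (a := -C i) (b := C i)).exists_bound_of_continuousOn u.continuous.continuousOn
    exact ⟨B, fun v => hB _ fun i _ => abs_le.1 (hC i v)⟩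
  | sup s φ ih =>
    obtain ⟨C, hC⟩ := ih
    refine ⟨C, fun v => abs_le.2 ⟨?_, ciSup_le fun a => (abs_le.1 (hC _)).2⟩⟩
    exact (abs_le.1 (hC _)).1.trans
      (le_ciSup (f := fun a => φ.eval M (extend M v a))
        ⟨C, by rintro _ ⟨a, rfl⟩; exact (abs_le.1 (hC _)).2⟩ (Classical.arbitrary _))
  | inf s φ ih =>
    obtain ⟨C, hC⟩ := ih
    refine ⟨C, fun v => abs_le.2 ⟨le_ciInf fun a => (abs_le.1 (hC _)).1, ?_⟩⟩
    exact (ciInf_le (f := fun a => φ.eval M (extend M v a))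
        ⟨-C, by rintro _ ⟨a, rfl⟩; exact (abs_le.1 (hC _)).1⟩ (Classical.arbitrary _)).trans
      (abs_le.1 (hC _)).2

/-- The value `σ^M` of a sentence. -/
noncomputable def Sentence.value (M : MetricStructure L) (σ : Sentence L) : ℝ :=
  Formula.eval M σ fun _ x => x.elim

/-- Elementary equivalence `M ≡ N`: every sentence has the same value in `M` and in `N`. -/
def ElemEquiv (M : MetricStructure L) (N : MetricStructure L) : Prop :=
  ∀ σ : Sentence L, Sentence.value M σ = Sentence.value N σ

/-! ### The language of tracial von Neumann algebras -/

/-- Function symbols of the language of tracial von Neumann algebras. The sort `n` stands for the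
operator norm ball of radius `n`. -/
inductive TracialFn : Type
  | zero : TracialFn
  | one : TracialFn
  | incl (m n : ℕ+) (h : m ≤ n) : TracialFn
  | add (m n : ℕ+) : TracialFn
  | smul (c : ℂ) (m n : ℕ+) (h : ‖c‖ * (m : ℝ) ≤ (n : ℝ)) : TracialFn
  | mul (m n : ℕ+) : TracialFn
  | star (n : ℕ+) : TracialFn

/-- Predicate symbols: the real and the imaginary part of the trace on each ball. -/
inductive TracialPr : Type
  | trRe (n : ℕ+) : TracialPr
  | trIm (n : ℕ+) : TracialPr

/-- The language of tracial von Neumann algebras. -/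
noncomputable def tracialLanguage : MetricLanguage where
  Srt := ℕ+
  diam := fun n => 2 * (n : ℝ)
  Fn := TracialFn
  fnArity := fun f => match f with
    | .zero => 0
    | .one => 0
    | .incl _ _ _ => 1
    | .add _ _ => 2
    | .smul _ _ _ _ => 1
    | .mul _ _ => 2
    | .star _ => 1
  fnDom := fun f => match f with
    | .zero => ![]
    | .one => ![]
    | .incl m _ _ => ![m]
    | .add m n => ![m, n]
    | .smul _ m _ _ => ![m]
    | .mul m n => ![m, n]
    | .star n => ![n]
  fnCod := fun f => match f with
    | .zero => 1
    | .one => 1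
    | .incl _ n _ => n
    | .add m n => m + n
    | .smul _ _ n _ => n
    | .mul m n => m * n
    | .star n => n
  fnMod := fun f => match f with
    | .zero => .linear ![]
    | .one => .linear ![]
    | .incl _ _ _ => .linear ![1]
    | .add _ _ => .linear ![1, 1]
    | .smul c _ _ _ => .linear ![‖c‖₊]
    | .mul m n => .linear ![(n : ℕ), (m : ℕ)]
    | .star _ => .linear ![1]
  Pr := TracialPr
  prArity := fun P => match P with
    | .trRe _ => 1
    | .trIm _ => 1
  prDom := fun P => match P with
    | .trRe n => ![n]
    | .trIm n => ![n]
  prMod := fun P => match P with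
    | .trRe _ => .linear ![1]
    | .trIm _ => .linear ![1]
  prLo := fun P => match P with
    | .trRe n => -(n : ℝ)
    | .trIm n => -(n : ℝ)
  prHi := fun P => match P with
    | .trRe n => (n : ℝ)
    | .trIm n => (n : ℝ)

end ContLogic

/-! ## Group von Neumann algebras -/

section StrongClosure

variable {E : Type*} [NormedAddCommGroup E] [InnerProductSpace ℂ E] [CompleteSpace E]

theorem star_mem_sotClosure (A : StarSubalgebra ℂ (E →L[ℂ] E)) (x : E →L[ℂ] E)
    (hx : ⇑x ∈ closure ((fun a : E →L[ℂ] E => (⇑a : E → E)) '' (A : Set (E →L[ℂ] E)))) :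
    ⇑(star x) ∈ closure ((fun a : E →L[ℂ] E => (⇑a : E → E)) '' (A : Set (E →L[ℂ] E))) := by
  rw [mem_closure_iff]
  intro U hU hxU
  obtain ⟨I, u, hu, hI⟩ := isOpen_pi_iff.1 hU _ hxU
  let T : (E →L[ℂ] E) →ₗ[ℂ] PiLp 2 (fun _ : I => E) :=
    { toFun := fun a => WithLp.toLp 2 (fun ξ => a ξ.1)
      map_add' := fun a b => by ext; simp
      map_smul' := fun c a => by ext; simp }
  let K : Submodule ℂ (PiLp 2 (fun _ : I => E)) := A.toSubalgebra.toSubmodule.map T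
  have hmem : T (star x) ∈ K.topologicalClosure := by
    rw [← Submodule.orthogonal_orthogonal_eq_closure, Submodule.mem_orthogonal]
    intro η hη
    have key : ∀ a ∈ A, ∑ ξ : I, inner ℂ (a (η ξ)) (ξ.1) = 0 := by
      intro a ha
      have := (Submodule.mem_orthogonal' _ _).1 hη (T (star a)) ⟨star a, A.star_mem' ha, rfl⟩
      simpa [T, PiLp.inner_apply, ContinuousLinearMap.star_eq_adjoint,
        ContinuousLinearMap.adjoint_inner_right] using this
    have hcl : IsClosed {f : E → E | ∑ ξ : I, inner ℂ (f (η ξ)) (ξ.1) = 0} :=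
      isClosed_eq (by fun_prop) continuous_const
    have : ⇑x ∈ {f : E → E | ∑ ξ : I, inner ℂ (f (η ξ)) (ξ.1) = 0} := by
      refine closure_minimal ?_ hcl hx
      rintro _ ⟨a, ha, rfl⟩
      exact key a ha
    simpa [T, PiLp.inner_apply, ContinuousLinearMap.star_eq_adjoint,
        ContinuousLinearMap.adjoint_inner_right] using this
  have hW : IsOpen {w : PiLp 2 (fun _ : I => E) | ∀ ξ : I, w ξ ∈ u ξ.1} := by
    simp only [Set.ofPred_forall]
    exact isOpen_iInter_of_finite fun ξ => (hu ξ.1 ξ.2).1.preimage (by fun_prop)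
  obtain ⟨w, hw, a, ha, rfl⟩ := mem_closure_iff.1 hmem _ hW (fun ξ => (hu ξ.1 ξ.2).2)
  exact ⟨⇑a, hI fun ξ hξ => hw ⟨ξ, hξ⟩, a, ha, rfl⟩

/-- The closure of a `*`-subalgebra of `B(E)` in the strong operator topology, that is, in the
topology of pointwise convergence on `E`. It is again a `*`-subalgebra. -/
def sotClosure (A : StarSubalgebra ℂ (E →L[ℂ] E)) : StarSubalgebra ℂ (E →L[ℂ] E) where
  carrier := {x | ⇑x ∈ closure ((fun a : E →L[ℂ] E => (⇑a : E → E)) '' (A : Set (E →L[ℂ] E)))}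
  mul_mem' := by
    intro x y hx hy
    have h1 : ∀ a ∈ A, ⇑(a * y) ∈ closure ((fun a : E →L[ℂ] E => (⇑a : E → E)) '' (A : Set (E →L[ℂ] E))) := by
      intro a ha
      refine map_mem_closure (f := fun f : E → E => fun ξ => a (f ξ)) (by fun_prop) hy ?_
      rintro _ ⟨b, hb, rfl⟩
      exact ⟨a * b, mul_mem ha hb, rfl⟩
    have h2 := map_mem_closure (f := fun f : E → E => fun ξ => f (y ξ)) (by fun_prop) hx
      (t := closure ((fun a : E →L[ℂ] E => (⇑a : E → E)) '' (A : Set (E →L[ℂ] E)))) (by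
        rintro _ ⟨a, ha, rfl⟩
        exact h1 a ha)
    rwa [closure_closure] at h2
  add_mem' := by
    intro x y hx hy
    refine map_mem_closure₂ (f := fun f g : E → E => f + g) (by fun_prop) hx hy ?_
    rintro _ ⟨a, ha, rfl⟩ _ ⟨b, hb, rfl⟩
    exact ⟨a + b, add_mem ha hb, rfl⟩
  algebraMap_mem' := fun c => subset_closure ⟨_, A.algebraMap_mem c, rfl⟩
  star_mem' := fun {x} hx => star_mem_sotClosure A x hx

end StrongClosure

namespace GroupVN

variable {G : Type*}

/-- The Hilbert space `ℓ²(G)`. -/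
abbrev EllTwo (G : Type*) : Type _ := lp (fun _ : G => ℂ) 2

/-- The basis vector `δ_g`. -/
noncomputable def delta (g : G) : EllTwo G := by
  classical exact lp.single 2 g 1

theorem memℓp_comp (e : G ≃ G) (ξ : EllTwo G) : Memℓp (fun h => ξ (e.symm h)) 2 := by
  have h2 : 0 < (2 : ENNReal).toReal := by norm_num
  refine memℓp_gen ?_
  exact (e.symm.summable_iff (f := fun h => ‖ξ h‖ ^ (2 : ENNReal).toReal)).2
    ((lp.memℓp ξ).summable h2)

/-- The isometry of `ℓ²(G)` with `δ_h ↦ δ_{e h}` for a permutation `e` of `G`. -/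
noncomputable def permIso (e : G ≃ G) : EllTwo G →ₗᵢ[ℂ] EllTwo G where
  toFun := fun ξ => ⟨fun h => ξ (e.symm h), memℓp_comp e ξ⟩
  map_add' := fun ξ η => rfl
  map_smul' := fun c ξ => rfl
  norm_map' := fun ξ => by
    have h2 : 0 < (2 : ENNReal).toReal := by norm_num
    rw [lp.norm_eq_tsum_rpow h2, lp.norm_eq_tsum_rpow h2]
    congr 1
    exact e.symm.tsum_eq fun h => ‖ξ h‖ ^ (2 : ENNReal).toReal

theorem permIso_apply (e : G ≃ G) (ξ : EllTwo G) (h : G) : permIso e ξ h = ξ (e.symm h) := rfl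

theorem permIso_delta (e : G ≃ G) (g : G) : permIso e (delta g) = delta (e g) := by
  classical
  ext h
  rw [permIso_apply]
  simp only [delta, lp.single_apply, Pi.single_apply, Equiv.symm_apply_eq]

theorem mem_of_delta_mem (S : Submodule ℂ (EllTwo G)) (hS : IsClosed (S : Set (EllTwo G)))
    (h : ∀ g, delta g ∈ S) (ξ : EllTwo G) : ξ ∈ S := by
  classical
  have h2 := lp.hasSum_single (E := fun _ : G => ℂ) (p := 2) (by norm_num) ξ
  refine hS.mem_of_tendsto h2 (Filter.Eventually.of_forall fun s => S.sum_mem fun g _ => ?_)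
  have : lp.single (E := fun _ : G => ℂ) 2 g (ξ g) = ξ g • delta g := by
    simp only [delta]
    rw [← lp.single_smul]
    simp
  rw [this]
  exact S.smul_mem _ (h g)

theorem norm_delta (g : G) : ‖(delta g : EllTwo G)‖ = 1 := by
  classical
  simp [delta, lp.norm_single]

variable [Group G]

/-- The left regular representation `g ↦ u_g`, `u_g δ_h = δ_{gh}`. -/
noncomputable def leftReg (G : Type*) [Group G] : G →* (EllTwo G →L[ℂ] EllTwo G) where
  toFun := fun g => (permIso (Equiv.mulLeft g)).toContinuousLinearMap
  map_one' := by
    ext ξ h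
    change permIso (Equiv.mulLeft 1) ξ h = ξ h
    rw [permIso_apply]
    change ξ ((1 : G)⁻¹ * h) = ξ h
    simp
  map_mul' := fun g k => by
    ext ξ h
    change permIso (Equiv.mulLeft (g * k)) ξ h =
      permIso (Equiv.mulLeft g) (permIso (Equiv.mulLeft k) ξ) h
    rw [permIso_apply, permIso_apply, permIso_apply]
    change ξ ((g * k)⁻¹ * h) = ξ (k⁻¹ * (g⁻¹ * h))
    simp [mul_assoc]

theorem leftReg_delta (g h : G) : leftReg G g (delta h) = delta (g * h) :=
  permIso_delta _ _

theorem star_leftReg (g : G) : star (leftReg G g) = leftReg G g⁻¹ := by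
  rw [ContinuousLinearMap.star_eq_adjoint]
  symm
  rw [ContinuousLinearMap.eq_adjoint_iff]
  intro ξ η
  have h : leftReg G g (leftReg G g⁻¹ ξ) = ξ := by
    change (leftReg G g * leftReg G g⁻¹) ξ = ξ
    rw [← map_mul]
    simp
  conv_rhs => rw [← h]
  exact ((permIso (Equiv.mulLeft g)).inner_map_map _ _).symm

/-- The linear extension `π : ℂ[G] → B(ℓ²(G))` of the left regular representation. -/
noncomputable def groupRingRep (G : Type*) [Group G] :
    MonoidAlgebra ℂ G →ₐ[ℂ] (EllTwo G →L[ℂ] EllTwo G) :=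
  MonoidAlgebra.lift ℂ (EllTwo G →L[ℂ] EllTwo G) G (leftReg G)

/-- The image of the group ring, a `*`-subalgebra of `B(ℓ²(G))`. -/
noncomputable def groupRingImage (G : Type*) [Group G] :
    StarSubalgebra ℂ (EllTwo G →L[ℂ] EllTwo G) where
  toSubalgebra := (groupRingRep G).range
  star_mem' := by
    rintro _ ⟨a, rfl⟩
    change star (groupRingRep G a) ∈ (groupRingRep G).range
    induction a using MonoidAlgebra.induction_on with
    | of g =>
      refine ⟨MonoidAlgebra.of ℂ G g⁻¹, ?_⟩
      change groupRingRep G _ = _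
      simp [groupRingRep, star_leftReg]
    | add a b ha hb =>
      rw [map_add, star_add]; exact add_mem ha hb
    | smul c a ha =>
      rw [map_smul, star_smul]; exact Subalgebra.smul_mem _ ha _

/-- The group von Neumann algebra `L(G)`: the closure of the image of `ℂ[G]` in `B(ℓ²(G))` in the
strong operator topology. -/
noncomputable def groupVN (G : Type*) [Group G] : StarSubalgebra ℂ (EllTwo G →L[ℂ] EllTwo G) :=
  sotClosure (groupRingImage G)

/-- The trace `tr(x) = ⟨x δ_e, δ_e⟩` (linear in the first variable in this notation; Mathlib's
inner product is linear in the second variable). -/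
noncomputable def trace (x : EllTwo G →L[ℂ] EllTwo G) : ℂ :=
  inner ℂ (delta (1 : G)) (x (delta 1))

/-- The norm `‖x‖₂ = √tr(x* x)`. -/
noncomputable def norm₂ (x : EllTwo G →L[ℂ] EllTwo G) : ℝ :=
  √(trace (star x * x)).re

/-- The right translation `ρ_k δ_h = δ_{h k}`. -/
noncomputable def rightTrans (k : G) : EllTwo G →ₗᵢ[ℂ] EllTwo G := permIso (Equiv.mulRight k)

theorem rightTrans_delta (k h : G) : rightTrans k (delta h) = delta (h * k) := permIso_delta _ _

theorem commute_rightTrans {x : EllTwo G →L[ℂ] EllTwo G} (hx : x ∈ groupVN G) (k : G)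
    (ξ : EllTwo G) : x (rightTrans k ξ) = rightTrans k (x ξ) := by
  have hcl : IsClosed {f : EllTwo G → EllTwo G | f (rightTrans k ξ) = rightTrans k (f ξ)} :=
    isClosed_eq (continuous_apply _) ((rightTrans k).continuous.comp (continuous_apply _))
  refine closure_minimal ?_ hcl hx
  rintro _ ⟨_, ⟨a, rfl⟩, rfl⟩
  change groupRingRep G a (rightTrans k ξ) = rightTrans k (groupRingRep G a ξ)
  induction a using MonoidAlgebra.induction_on with
  | of g =>
    have h1 : groupRingRep G (MonoidAlgebra.of ℂ G g) = leftReg G g := by simp [groupRingRep]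
    rw [h1]
    ext h
    change ξ (g⁻¹ * h * k⁻¹) = ξ (g⁻¹ * (h * k⁻¹))
    rw [mul_assoc]
  | add a b ha hb => simp [ha, hb]
  | smul c a ha => simp [ha]

theorem apply_delta {x : EllTwo G →L[ℂ] EllTwo G} (hx : x ∈ groupVN G) (g : G) :
    x (delta g) = rightTrans g (x (delta 1)) := by
  rw [← commute_rightTrans hx, rightTrans_delta, one_mul]

theorem eq_zero_of_apply_delta_one {x : EllTwo G →L[ℂ] EllTwo G} (hx : x ∈ groupVN G)
    (h : x (delta 1) = 0) : x = 0 := by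
  ext1 ξ
  refine mem_of_delta_mem (LinearMap.ker x.toLinearMap) x.isClosed_ker (fun g => ?_) ξ
  change x (delta g) = 0
  rw [apply_delta hx, h, map_zero]

theorem norm₂_eq (x : EllTwo G →L[ℂ] EllTwo G) : norm₂ x = ‖x (delta 1)‖ := by
  have : trace (star x * x) = inner ℂ (x (delta 1)) (x (delta (1 : G))) := by
    rw [trace, mul_apply_eq_comp, ContinuousLinearMap.star_eq_adjoint,
      ContinuousLinearMap.adjoint_inner_right]
  rw [norm₂, this, norm_eq_sqrt_re_inner (𝕜 := ℂ)]
  rfl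

theorem norm₂_le (x : EllTwo G →L[ℂ] EllTwo G) : norm₂ x ≤ ‖x‖ := by
  simpa [norm₂_eq, norm_delta] using x.le_opNorm (delta 1)

theorem abs_trace_le (x : EllTwo G →L[ℂ] EllTwo G) : ‖trace x‖ ≤ norm₂ x := by
  simpa [norm₂_eq, norm_delta, trace] using norm_inner_le_norm (𝕜 := ℂ) (delta (1 : G)) (x (delta 1))

theorem norm₂_star {x : EllTwo G →L[ℂ] EllTwo G} (hx : x ∈ groupVN G) :
    norm₂ (star x) = norm₂ x := by
  classical
  have h2 : 0 < (2 : ENNReal).toReal := by norm_num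
  have key : ∀ g : G, ‖star x (delta 1) g‖ = ‖x (delta 1) g⁻¹‖ := by
    intro g
    have e1 : inner ℂ (delta g) (star x (delta 1)) = star x (delta 1) g := by
      simp [delta, lp.inner_single_left]
    have e2 : inner ℂ (delta g⁻¹) (x (delta 1)) = x (delta 1) g⁻¹ := by
      simp [delta, lp.inner_single_left]
    rw [← e1, ← e2, ContinuousLinearMap.star_eq_adjoint,
      ContinuousLinearMap.adjoint_inner_right, apply_delta hx, norm_inner_symm,
      ← (rightTrans g).inner_map_map (delta g⁻¹), rightTrans_delta, inv_mul_cancel]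
  rw [norm₂_eq, norm₂_eq, lp.norm_eq_tsum_rpow h2, lp.norm_eq_tsum_rpow h2]
  simp only [key]
  congr 1
  exact (Equiv.inv G).tsum_eq fun g => ‖x (delta 1) g‖ ^ (2 : ENNReal).toReal

theorem norm₂_mul_le_left (x y : EllTwo G →L[ℂ] EllTwo G) : norm₂ (x * y) ≤ ‖x‖ * norm₂ y := by
  simpa [norm₂_eq] using x.le_opNorm (y (delta 1))

theorem norm₂_mul_le_right {x y : EllTwo G →L[ℂ] EllTwo G} (hx : x ∈ groupVN G)
    (hy : y ∈ groupVN G) : norm₂ (x * y) ≤ ‖y‖ * norm₂ x := by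
  rw [← norm₂_star (mul_mem hx hy), star_mul, ← norm₂_star hx]
  rw [← norm_star y]
  exact norm₂_mul_le_left (star y) (star x)

theorem norm₂_add_le (x y : EllTwo G →L[ℂ] EllTwo G) : norm₂ (x + y) ≤ norm₂ x + norm₂ y := by
  simpa [norm₂_eq] using norm_add_le (x (delta 1)) (y (delta 1))

theorem norm₂_smul (c : ℂ) (x : EllTwo G →L[ℂ] EllTwo G) : norm₂ (c • x) = ‖c‖ * norm₂ x := by
  simp [norm₂_eq, norm_smul]

theorem trace_sub (x y : EllTwo G →L[ℂ] EllTwo G) : trace (x - y) = trace x - trace y := by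
  simp [trace]

/-- The operator norm ball of radius `n` of `L(G)`. -/
@[ext]
structure Ball (G : Type*) [Group G] (n : ℕ+) where
  val : EllTwo G →L[ℂ] EllTwo G
  mem : val ∈ groupVN G
  norm_le : ‖val‖ ≤ (n : ℝ)

/-- The metric `d(x, y) = ‖x - y‖₂` on the balls. -/
noncomputable instance ballMetric (n : ℕ+) : MetricSpace (Ball G n) where
  dist := fun x y => norm₂ (x.val - y.val)
  dist_self := fun x => by simp [norm₂_eq]
  dist_comm := fun x y => by simp [norm₂_eq, norm_sub_rev]
  dist_triangle := fun x y z => by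
    simpa using norm₂_add_le (x.val - y.val) (y.val - z.val)
  eq_of_dist_eq_zero := fun {x y} h => by
    refine Ball.ext (sub_eq_zero.1 (eq_zero_of_apply_delta_one (sub_mem x.mem y.mem) ?_))
    exact norm_eq_zero.1 ((norm₂_eq _).symm.trans h)

theorem ball_dist (n : ℕ+) (x y : Ball G n) : dist x y = norm₂ (x.val - y.val) := rfl

instance ballNonempty (n : ℕ+) : Nonempty (Ball G n) := ⟨⟨0, zero_mem _, by simp⟩⟩

theorem ball_cauchySeq {n : ℕ+} {u : ℕ → Ball G n} (hu : CauchySeq u) (ξ : EllTwo G) :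
    CauchySeq fun k => (u k).val ξ := by
  let S : Submodule ℂ (EllTwo G) :=
    { carrier := {ξ | CauchySeq fun k => (u k).val ξ}
      zero_mem' := by simpa using cauchySeq_const (0 : EllTwo G)
      add_mem' := fun {ξ η} hξ hη => by
        have h1 : CauchySeq fun k => (u k).val ξ := hξ
        have h2 : CauchySeq fun k => (u k).val η := hη
        simpa using! h1.add h2
      smul_mem' := fun c ξ hξ => by
        have h1 : CauchySeq fun k => (u k).val ξ := hξ
        simpa using! (uniformContinuous_const_smul c).comp_cauchySeq h1 }
  have hn : (0 : ℝ) < n := by exact_mod_cast n.pos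
  have hS : IsClosed (S : Set (EllTwo G)) := by
    refine isClosed_of_closure_subset fun ξ hξ => ?_
    refine Metric.cauchySeq_iff.2 fun ε hε => ?_
    obtain ⟨η, hη, hd⟩ := Metric.mem_closure_iff.1 hξ (ε / (3 * n)) (by positivity)
    obtain ⟨N, hN⟩ := Metric.cauchySeq_iff.1 (show CauchySeq fun k => (u k).val η from hη)
      (ε / 3) (by positivity)
    refine ⟨N, fun k hk l hl => ?_⟩
    have hb : ∀ j, dist ((u j).val ξ) ((u j).val η) < ε / 3 := fun j => by
      rw [dist_eq_norm, ← map_sub]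
      calc ‖(u j).val (ξ - η)‖ ≤ n * ‖ξ - η‖ := (u j).val.le_of_opNorm_le (u j).norm_le _
        _ < n * (ε / (3 * n)) := by
          rw [← dist_eq_norm]; exact mul_lt_mul_of_pos_left hd hn
        _ = ε / 3 := by field_simp
    have h1 := dist_triangle4 ((u k).val ξ) ((u k).val η) ((u l).val η) ((u l).val ξ)
    have h2 := hb l
    rw [dist_comm] at h2
    linarith [hb k, hN k hk l hl]
  refine mem_of_delta_mem S hS (fun g => ?_) ξ
  refine Metric.cauchySeq_iff.2 fun ε hε => ?_
  obtain ⟨N, hN⟩ := Metric.cauchySeq_iff.1 hu ε hε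
  refine ⟨N, fun k hk l hl => ?_⟩
  rw [apply_delta (u k).mem, apply_delta (u l).mem, (rightTrans g).dist_map, dist_eq_norm]
  have := hN k hk l hl
  rwa [ball_dist, norm₂_eq] at this

instance ballComplete (n : ℕ+) : CompleteSpace (Ball G n) := by
  refine Metric.complete_of_cauchySeq_tendsto fun u hu => ?_
  choose f hf using fun ξ => cauchySeq_tendsto_of_complete (ball_cauchySeq hu ξ)
  have hlim : Filter.Tendsto (fun k ξ => (u k).val ξ) Filter.atTop (nhds f) := tendsto_pi_nhds.2 hf
  have hbd : Bornology.IsBounded (Set.range fun k => (u k).val) :=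
    (isBounded_iff_forall_norm_le).2 ⟨n, by rintro _ ⟨k, rfl⟩; exact (u k).norm_le⟩
  let x : EllTwo G →L[ℂ] EllTwo G :=
    ContinuousLinearMap.ofTendstoOfBoundedRange f (fun k => (u k).val) hlim hbd
  have hx : x ∈ groupVN G :=
    isClosed_closure.mem_of_tendsto hlim (Filter.Eventually.of_forall fun k => (u k).mem)
  have hxn : ‖x‖ ≤ (n : ℝ) := by
    refine x.opNorm_le_bound (by positivity) fun ξ => ?_
    exact le_of_tendsto (hf ξ).norm
      (Filter.Eventually.of_forall fun k => (u k).val.le_of_opNorm_le (u k).norm_le ξ)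
  refine ⟨⟨x, hx, hxn⟩, tendsto_iff_dist_tendsto_zero.2 ?_⟩
  have := tendsto_iff_dist_tendsto_zero.1 (hf (delta 1))
  refine this.congr fun k => ?_
  change _ = norm₂ ((u k).val - x)
  rw [norm₂_eq, dist_eq_norm]
  rfl

/-- Addition `D_m × D_n → D_{m+n}`. -/
noncomputable def ballAdd (m n : ℕ+) (x : Ball G m) (y : Ball G n) : Ball G (m + n) :=
  ⟨x.val + y.val, add_mem x.mem y.mem, by
    rw [PNat.add_coe, Nat.cast_add]
    exact (norm_add_le _ _).trans (add_le_add x.norm_le y.norm_le)⟩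

/-- Scalar multiplication `D_m → D_n` by `c`, where `|c| m ≤ n`. -/
noncomputable def ballSMul (c : ℂ) (m n : ℕ+) (h : ‖c‖ * (m : ℝ) ≤ (n : ℝ)) (x : Ball G m) :
    Ball G n :=
  ⟨c • x.val, (groupVN G).smul_mem x.mem c, by
    rw [norm_smul]
    exact (mul_le_mul_of_nonneg_left x.norm_le (norm_nonneg c)).trans h⟩

/-- Multiplication `D_m × D_n → D_{mn}`. -/
noncomputable def ballMul (m n : ℕ+) (x : Ball G m) (y : Ball G n) : Ball G (m * n) :=
  ⟨x.val * y.val, mul_mem x.mem y.mem, by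
    rw [PNat.mul_coe, Nat.cast_mul]
    exact (norm_mul_le _ _).trans
      (mul_le_mul x.norm_le y.norm_le (norm_nonneg _) (Nat.cast_nonneg _))⟩

/-- The adjoint `D_n → D_n`. -/
noncomputable def ballStar (n : ℕ+) (x : Ball G n) : Ball G n :=
  ⟨star x.val, star_mem x.mem, (norm_star x.val).trans_le x.norm_le⟩

/-- The inclusion `D_m → D_n` for `m ≤ n`. -/
def ballIncl (m n : ℕ+) (h : m ≤ n) (x : Ball G m) : Ball G n :=
  ⟨x.val, x.mem, x.norm_le.trans (by exact_mod_cast h)⟩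

/-- The constant `0` in the unit ball. -/
noncomputable def ballZero : Ball G 1 := ⟨0, zero_mem _, by simp⟩

/-- The constant `1` in the unit ball. -/
noncomputable def ballOne : Ball G 1 :=
  ⟨1, one_mem _, ContinuousLinearMap.norm_id_le.trans (by simp)⟩

theorem ballAdd_dist (m n : ℕ+) (x x' : Ball G m) (y y' : Ball G n) :
    dist (ballAdd m n x y) (ballAdd m n x' y') ≤
      ((1 : ℝ≥0) : ℝ) * nndist x x' + ((1 : ℝ≥0) : ℝ) * nndist y y' := by
  change norm₂ (x.val + y.val - (x'.val + y'.val)) ≤ _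
  rw [add_sub_add_comm, NNReal.coe_one, one_mul, one_mul]
  exact norm₂_add_le _ _

theorem ballSMul_dist (c : ℂ) (m n : ℕ+) (h : ‖c‖ * (m : ℝ) ≤ (n : ℝ)) (x x' : Ball G m) :
    dist (ballSMul c m n h x) (ballSMul c m n h x') ≤ (‖c‖₊ : ℝ) * nndist x x' := by
  change norm₂ (c • x.val - c • x'.val) ≤ _
  rw [← smul_sub, norm₂_smul]
  exact le_refl _

theorem ballMul_dist (m n : ℕ+) (x x' : Ball G m) (y y' : Ball G n) :
    dist (ballMul m n x y) (ballMul m n x' y') ≤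
      (((n : ℕ) : ℝ≥0) : ℝ) * nndist x x' + (((m : ℕ) : ℝ≥0) : ℝ) * nndist y y' := by
  change norm₂ (x.val * y.val - x'.val * y'.val) ≤ _
  have e : x.val * y.val - x'.val * y'.val = (x.val - x'.val) * y.val + x'.val * (y.val - y'.val) := by
    rw [sub_mul, mul_sub]; abel
  rw [e, NNReal.coe_natCast, NNReal.coe_natCast]
  refine (norm₂_add_le _ _).trans (add_le_add ?_ ?_)
  · exact (norm₂_mul_le_right (sub_mem x.mem x'.mem) y.mem).trans
      (mul_le_mul_of_nonneg_right y.norm_le (Real.sqrt_nonneg _))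
  · exact (norm₂_mul_le_left _ _).trans
      (mul_le_mul_of_nonneg_right x'.norm_le (Real.sqrt_nonneg _))

theorem ballStar_dist (n : ℕ+) (x x' : Ball G n) :
    dist (ballStar n x) (ballStar n x') ≤ ((1 : ℝ≥0) : ℝ) * nndist x x' := by
  change norm₂ (star x.val - star x'.val) ≤ _
  rw [← star_sub, norm₂_star (sub_mem x.mem x'.mem), NNReal.coe_one, one_mul]
  exact le_refl _

theorem ballIncl_dist (m n : ℕ+) (h : m ≤ n) (x x' : Ball G m) :
    dist (ballIncl m n h x) (ballIncl m n h x') ≤ ((1 : ℝ≥0) : ℝ) * nndist x x' := by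
  rw [NNReal.coe_one, one_mul]
  exact le_refl _

theorem ball_trace_sub_le (n : ℕ+) (x x' : Ball G n) :
    ‖trace x.val - trace x'.val‖ ≤ ((1 : ℝ≥0) : ℝ) * nndist x x' := by
  rw [← trace_sub, NNReal.coe_one, one_mul]
  exact abs_trace_le _

open ContLogic in
/-- `L(G)` as a metric structure: the sort `n` is the operator norm ball of radius `n` with the
metric given by `‖·‖₂`; the symbols are interpreted by `0`, `1`, the inclusions between balls,
addition, scalar multiplication, multiplication, adjoint, and real and imaginary part of the
trace. -/
noncomputable def groupVNStructure (G : Type*) [Group G] : MetricStructure tracialLanguage where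
  carrier := fun n : ℕ+ => Ball G n
  metric := fun n : ℕ+ => ballMetric n
  nonempty := fun n : ℕ+ => ballNonempty n
  complete := fun n : ℕ+ => ballComplete n
  dist_le := fun (n : ℕ+) (x y : Ball G n) => by
    change norm₂ (x.val - y.val) ≤ 2 * (n : ℝ)
    linarith [norm₂_le (x.val - y.val), norm_sub_le x.val y.val, x.norm_le, y.norm_le]
  fn := fun f => match f with
    | .zero => fun _ => ballZero
    | .one => fun _ => ballOne
    | .incl m n h => fun x => ballIncl m n h (x (0 : Fin 1))
    | .add m n => fun x => ballAdd m n (x (0 : Fin 2)) (x (1 : Fin 2))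
    | .smul c m n h => fun x => ballSMul c m n h (x (0 : Fin 1))
    | .mul m n => fun x => ballMul m n (x (0 : Fin 2)) (x (1 : Fin 2))
    | .star n => fun x => ballStar n (x (0 : Fin 1))
  fn_obeys := fun f => match f with
    | .zero => fun _ _ => (dist_self (ballZero (G := G))).trans_le (NNReal.coe_nonneg _)
    | .one => fun _ _ => (dist_self (ballOne (G := G))).trans_le (NNReal.coe_nonneg _)
    | .incl m n h => fun _ _ => Modulus.le_linear_one (ballIncl_dist m n h _ _)
    | .add m n => fun _ _ => Modulus.le_linear_two (ballAdd_dist m n _ _ _ _)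
    | .smul c m n h => fun _ _ => Modulus.le_linear_one (ballSMul_dist c m n h _ _)
    | .mul m n => fun _ _ => Modulus.le_linear_two (ballMul_dist m n _ _ _ _)
    | .star n => fun _ _ => Modulus.le_linear_one (ballStar_dist n _ _)
  pr := fun P => match P with
    | .trRe n => fun x => (trace (x (0 : Fin 1) : Ball G n).val).re
    | .trIm n => fun x => (trace (x (0 : Fin 1) : Ball G n).val).im
  pr_mem := fun P => match P with
    | .trRe n => fun x => abs_le.1 ((Complex.abs_re_le_norm _).trans
        ((abs_trace_le _).trans ((norm₂_le _).trans (x (0 : Fin 1) : Ball G n).norm_le)))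
    | .trIm n => fun x => abs_le.1 ((Complex.abs_im_le_norm _).trans
        ((abs_trace_le _).trans ((norm₂_le _).trans (x (0 : Fin 1) : Ball G n).norm_le)))
  pr_obeys := fun P => match P with
    | .trRe n => fun _ _ => Modulus.le_linear_one
        ((Complex.abs_re_le_norm (_ - _)).trans (ball_trace_sub_le n _ _))
    | .trIm n => fun _ _ => Modulus.le_linear_one
        ((Complex.abs_im_le_norm (_ - _)).trans (ball_trace_sub_le n _ _))

end GroupVN

/-!
For tuples `a` in `G` and `b` in `H` with the same quantifier-free type, the pairs `(aᵢ, bᵢ)`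
generate the graph `K ≤ G × H` of an isomorphism `⟨a⟩ ≃ ⟨b⟩`. The group ring of `K` maps to both
`B(ℓ²(G))` and `B(ℓ²(H))`; two operators that are images of the same element are called linked.
The trace of a group ring element only depends on which group elements are trivial, so linked
operators have the same trace, and hence the same norm `‖·‖₂` (`trace_eq_of_mem_linkAlgebra`,
`norm₂_eq_of_mem_linkAlgebra`). Since linked pairs are closed under all operations of the language,
atomic formulas take the same value at linked assignments.

The back-and-forth game on the groups yields one on the balls of `L(G)` and `L(H)`. An element `x`
of the ball of radius `n` of `L(G)` is `‖·‖₂`-close to a group ring element `y` with `‖y‖ ≤ n` by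
Kaplansky density (`exists_groupRingImage_norm_le`). Answering the finite support of `y` in the
game on the groups gives a group ring element `z` of `H` linked to `y` (`exists_link`), and `z` lies
in the ball of radius `n` as well: `‖z‖` is tested on vectors `w δ_e` with `w` in the group ring of
`H`, and one further move of the game links `w` to some `w'` in the group ring of `G`, so that
`‖z w‖₂ = ‖y w'‖₂ ≤ ‖y‖ ‖w'‖₂ = ‖y‖ ‖w‖₂` (`norm_snd_le_of_mem_linkAlgebra`). Thus a quantifier
costs two moves. As formulas are uniformly continuous (`Formula.eval_uniform`), every formula is
preserved by the game of some finite length (`exists_rank_eval_eq`), and rank `ω` allows games of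
every finite length.

Kaplansky density has a short proof in this setting. A contraction `x` in `L(G)` is
`2y(1 + y⋆y)⁻¹` for some `y` in `L(G)`. If `a` in the group ring is `‖·‖₂`-close to `y`, then
`2a(1 + a⋆a)⁻¹` is a contraction in the norm closure of the group ring, and it is `‖·‖₂`-close to
`x` by the resolvent identity `mul_resolventStarMul_sub`. The latter estimate involves `y⋆ - a⋆` as
well, which is small because `‖·‖₂` is invariant under the adjoint on `L(G)`.
-/

/-! ### The contraction `2a(1 + a⋆a)⁻¹` -/

section Contraction

variable {A : Type*} [CStarAlgebra A]

/-- The resolvent `(1 + a⋆a)⁻¹`. -/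
noncomputable def resolventStarMul (a : A) : A :=
  cfc (fun t : ℝ => (1 + t)⁻¹) (star a * a)

theorem continuousOn_inv_one_add_spectrum (a : A) :
    ContinuousOn (fun t : ℝ => (1 + t)⁻¹) (spectrum ℝ (star a * a)) :=
  ContinuousOn.inv₀ (by fun_prop) fun t ht => by
    have : 0 ≤ t := spectrum_star_mul_self_nonneg t ht
    positivity

theorem one_add_mul_resolventStarMul (a : A) : (1 + star a * a) * resolventStarMul a = 1 := by
  have h1 : (1 + star a * a) = cfc (fun t : ℝ => 1 + t) (star a * a) := by
    rw [cfc_const_add (1 : ℝ) (fun t => t) (star a * a), cfc_id' ℝ (star a * a)]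
    simp
  have h2 := continuousOn_inv_one_add_spectrum a
  conv_lhs => rw [h1, resolventStarMul, ← cfc_mul _ _ (star a * a) (by fun_prop) h2]
  rw [← cfc_one ℝ (star a * a)]
  refine cfc_congr fun t ht => ?_
  have : 0 ≤ t := spectrum_star_mul_self_nonneg t ht
  simp only [Pi.one_apply]
  field_simp

theorem resolventStarMul_mul_one_add (a : A) : resolventStarMul a * (1 + star a * a) = 1 := by
  have h : IsSelfAdjoint (resolventStarMul a) := cfc_predicate _ _
  have := congrArg star (one_add_mul_resolventStarMul a)
  simpa [h.star_eq] using this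

theorem norm_resolventStarMul_le (a : A) : ‖resolventStarMul a‖ ≤ 1 := by
  refine norm_cfc_le zero_le_one fun t ht => ?_
  have : 0 ≤ t := spectrum_star_mul_self_nonneg t ht
  rw [Real.norm_of_nonneg (by positivity)]
  exact inv_le_one_of_one_le₀ (by linarith)

theorem star_mul_cfc_mul_self (a : A) {g : ℝ → ℝ} (hg : ContinuousOn g (spectrum ℝ (star a * a))) :
    star (a * cfc g (star a * a)) * (a * cfc g (star a * a)) =
      cfc (fun t => t * g t ^ 2) (star a * a) := by
  have h : IsSelfAdjoint (cfc g (star a * a)) := cfc_predicate _ _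
  have e : (fun t => t * g t ^ 2) = fun t => g t * (t * g t) := by ext; ring
  rw [e, cfc_mul g (fun t => t * g t) (star a * a) hg (by fun_prop),
    cfc_mul (fun t => t) g (star a * a) (by fun_prop) hg, cfc_id' ℝ (star a * a), star_mul,
    h.star_eq]
  simp only [mul_assoc]

/-- The function `r ↦ 2r / (1 + r²)` takes values in `[-1, 1]`. -/
theorem norm_mul_resolventStarMul_le (a : A) : ‖a * resolventStarMul a‖ ≤ 1 / 2 := by
  have h : ‖a * resolventStarMul a‖ * ‖a * resolventStarMul a‖ ≤ 1 / 4 := by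
    rw [← CStarRing.norm_star_mul_self, resolventStarMul,
      star_mul_cfc_mul_self a (continuousOn_inv_one_add_spectrum a)]
    refine norm_cfc_le (by norm_num) fun t ht => ?_
    have : 0 ≤ t := spectrum_star_mul_self_nonneg t ht
    rw [Real.norm_of_nonneg (by positivity), inv_pow, ← div_eq_mul_inv,
      div_le_div_iff₀ (by positivity) (by norm_num)]
    nlinarith [sq_nonneg (1 - t)]
  nlinarith [norm_nonneg (a * resolventStarMul a)]

theorem resolventStarMul_star_mul (a : A) :
    resolventStarMul (star a) * a = a * resolventStarMul a := by
  have h1 := resolventStarMul_mul_one_add (star a)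
  have h2 := one_add_mul_resolventStarMul a
  rw [star_star] at h1
  calc resolventStarMul (star a) * a
      = resolventStarMul (star a) * a * ((1 + star a * a) * resolventStarMul a) := by
        rw [h2, mul_one]
    _ = (resolventStarMul (star a) * (1 + a * star a)) * a * resolventStarMul a := by noncomm_ring
    _ = a * resolventStarMul a := by rw [h1, one_mul]

/-- The resolvent identity that compares `a(1 + a⋆a)⁻¹` with `y(1 + y⋆y)⁻¹`: the differences
`a - y` and `y⋆ - a⋆` occur linearly, with bounded coefficients. -/
theorem mul_resolventStarMul_sub (a y : A) :
    a * resolventStarMul a - y * resolventStarMul y =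
      resolventStarMul (star a) * (a - y) * resolventStarMul y +
        a * resolventStarMul a * (star y - star a) * (y * resolventStarMul y) := by
  have h1 := resolventStarMul_mul_one_add (star a)
  have h2 := one_add_mul_resolventStarMul y
  rw [star_star] at h1
  calc a * resolventStarMul a - y * resolventStarMul y
      = resolventStarMul (star a) * a * ((1 + star y * y) * resolventStarMul y) -
          (resolventStarMul (star a) * (1 + a * star a)) * y * resolventStarMul y := by
        rw [h1, h2, mul_one, one_mul, resolventStarMul_star_mul]
    _ = resolventStarMul (star a) * (a - y) * resolventStarMul y +
          resolventStarMul (star a) * a * (star y - star a) * (y * resolventStarMul y) := by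
        noncomm_ring
    _ = _ := by rw [resolventStarMul_star_mul]

theorem resolventStarMul_mem {S : StarSubalgebra ℂ A} (hS : IsClosed (S : Set A)) {a : A}
    (ha : a ∈ S) : resolventStarMul a ∈ S :=
  cfc_mem _ (mul_mem (star_mem ha) ha)

/-- Every contraction `x` is of the form `2y(1 + y⋆y)⁻¹`, with
`y = x (1 + √(1 - x⋆x))⁻¹`. -/
theorem exists_two_smul_mul_resolventStarMul_eq {S : StarSubalgebra ℂ A}
    (hS : IsClosed (S : Set A)) {x : A} (hxS : x ∈ S) (hx : ‖x‖ ≤ 1) :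
    ∃ y ∈ S, (2 : ℂ) • (y * resolventStarMul y) = x := by
  nontriviality A
  let g : ℝ → ℝ := fun t => (1 + √(1 - t))⁻¹
  have hg : Continuous g := by
    refine Continuous.inv₀ (by fun_prop) fun t => ?_
    positivity
  refine ⟨x * cfc g (star x * x), mul_mem hxS (cfc_mem _ (mul_mem (star_mem hxS) hxS)), ?_⟩
  set y := x * cfc g (star x * x) with hy
  have key : (2 : ℂ) • y = x * (1 + star y * y) := by
    rw [hy, star_mul_cfc_mul_self x hg.continuousOn]
    have h1 : (1 + cfc (fun t => t * g t ^ 2) (star x * x) : A) =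
        cfc (fun t => 1 + t * g t ^ 2) (star x * x) := by
      rw [cfc_const_add (1 : ℝ) (fun t => t * g t ^ 2) (star x * x)]
      simp
    have h2 : (2 : ℂ) • (x * cfc g (star x * x)) = x * cfc (fun t => 2 * g t) (star x * x) := by
      rw [cfc_const_mul (2 : ℝ) g (star x * x), mul_smul_comm, ofNat_smul_eq_nsmul ℂ 2,
        ofNat_smul_eq_nsmul ℝ 2]
    rw [h1, h2]
    congr 1
    refine cfc_congr fun t ht => ?_
    have ht1 : t ≤ 1 := by
      have h3 : ‖t‖ ≤ ‖star x * x‖ := spectrum.norm_le_norm_of_mem ht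
      rw [CStarRing.norm_star_mul_self] at h3
      have := le_abs_self t
      rw [Real.norm_eq_abs] at h3
      nlinarith [norm_nonneg x]
    have hs : √(1 - t) ^ 2 = 1 - t := Real.sq_sqrt (by linarith)
    have hs0 : 0 ≤ √(1 - t) := Real.sqrt_nonneg _
    simp only [g]
    field_simp
    linear_combination -hs
  rw [← smul_mul_assoc, key, mul_assoc, one_add_mul_resolventStarMul, mul_one]

end Contraction

/-! ### Kaplansky density for `L(G)` in the norm `‖·‖₂` -/

namespace GroupVN

variable {G : Type*} [Group G]

theorem isClosed_groupVN : IsClosed (groupVN G : Set (EllTwo G →L[ℂ] EllTwo G)) :=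
  isClosed_closure.preimage (continuous_pi fun ξ => by fun_prop)

theorem groupRingImage_le_groupVN : groupRingImage G ≤ groupVN G :=
  fun x hx => subset_closure ⟨x, hx, rfl⟩

theorem norm₂_nonneg (x : EllTwo G →L[ℂ] EllTwo G) : 0 ≤ norm₂ x := Real.sqrt_nonneg _

/-- On `L(G)`, `‖·‖₂` is the norm of the value at `δ_e`, so `‖·‖₂` approximation is a case of
strong operator approximation. -/
theorem exists_groupRingImage_norm₂_sub_lt {x : EllTwo G →L[ℂ] EllTwo G} (hx : x ∈ groupVN G)
    {ε : ℝ} (hε : 0 < ε) : ∃ a ∈ groupRingImage G, norm₂ (a - x) < ε := by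
  have hU : IsOpen {f : EllTwo G → EllTwo G | ‖f (delta 1) - x (delta 1)‖ < ε} :=
    isOpen_lt (by fun_prop) continuous_const
  obtain ⟨_, hf, a, ha, rfl⟩ := mem_closure_iff.1 hx _ hU (by simpa using hε)
  exact ⟨a, ha, by rw [norm₂_eq]; exact hf⟩

/-- The map `a ↦ a(1 + a⋆a)⁻¹` is Lipschitz for `‖·‖₂` on `L(G)`, with a constant that does
not depend on operator norms. -/
theorem norm₂_resolvent_sub_le {a y : EllTwo G →L[ℂ] EllTwo G} (ha : a ∈ groupVN G)
    (hy : y ∈ groupVN G) :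
    norm₂ (a * resolventStarMul a - y * resolventStarMul y) ≤ 2 * norm₂ (a - y) := by
  have hR : ∀ {z}, z ∈ groupVN G → resolventStarMul z ∈ groupVN G := fun hz =>
    resolventStarMul_mem isClosed_groupVN hz
  have h0 := norm₂_nonneg (a - y)
  have e : norm₂ (star y - star a) = norm₂ (a - y) := by
    rw [← star_sub, norm₂_star (sub_mem hy ha), norm₂_eq, norm₂_eq, ← neg_sub a y]
    simp [norm_sub_rev]
  rw [mul_resolventStarMul_sub]
  refine (norm₂_add_le _ _).trans ?_
  have h1 : norm₂ (resolventStarMul (star a) * (a - y) * resolventStarMul y) ≤ norm₂ (a - y) := by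
    refine (norm₂_mul_le_right (mul_mem (hR (star_mem ha)) (sub_mem ha hy)) (hR hy)).trans ?_
    refine (mul_le_of_le_one_left (norm₂_nonneg _) (norm_resolventStarMul_le y)).trans ?_
    refine (norm₂_mul_le_left _ _).trans ?_
    exact mul_le_of_le_one_left h0 (norm_resolventStarMul_le _)
  have h2 : norm₂ (a * resolventStarMul a * (star y - star a) * (y * resolventStarMul y)) ≤
      norm₂ (a - y) := by
    refine (norm₂_mul_le_right (mul_mem (mul_mem ha (hR ha))
      (sub_mem (star_mem hy) (star_mem ha))) (mul_mem hy (hR hy))).trans ?_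
    refine (mul_le_of_le_one_left (norm₂_nonneg _)
      ((norm_mul_resolventStarMul_le y).trans (by norm_num))).trans ?_
    refine (norm₂_mul_le_left _ _).trans ?_
    rw [e]
    exact mul_le_of_le_one_left h0 ((norm_mul_resolventStarMul_le a).trans (by norm_num))
  linarith

theorem exists_groupRingImage_norm_le_one {x : EllTwo G →L[ℂ] EllTwo G} (hx : x ∈ groupVN G)
    (hx1 : ‖x‖ ≤ 1) {ε : ℝ} (hε : 0 < ε) :
    ∃ c ∈ groupRingImage G, ‖c‖ ≤ 1 ∧ norm₂ (x - c) < ε := by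
  obtain ⟨y, hy, hyx⟩ := exists_two_smul_mul_resolventStarMul_eq isClosed_groupVN hx hx1
  -- `x`, `F`, `b` and the rescaled `b` are at successive distances at most `4δ`, `δ`, `δ`.
  obtain ⟨δ, hδ, hδε⟩ : ∃ δ : ℝ, 0 < δ ∧ 6 * δ ≤ ε := ⟨ε / 6, by positivity, by linarith⟩
  obtain ⟨a, ha, hay⟩ := exists_groupRingImage_norm₂_sub_lt hy hδ
  set F := (2 : ℂ) • (a * resolventStarMul a) with hF
  have hF1 : ‖F‖ ≤ 1 := by
    have := norm_mul_resolventStarMul_le a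
    rw [hF, norm_smul, Complex.norm_ofNat]
    linarith
  have hxF : norm₂ (x - F) ≤ 4 * δ := by
    have h := norm₂_resolvent_sub_le (groupRingImage_le_groupVN ha) hy
    have e : norm₂ (x - F) = 2 * norm₂ (a * resolventStarMul a - y * resolventStarMul y) := by
      rw [← Complex.norm_ofNat 2, ← norm₂_smul, smul_sub]
      change _ = norm₂ (F - (2 : ℂ) • (y * resolventStarMul y))
      rw [hyx, norm₂_eq, norm₂_eq]
      simp [norm_sub_rev]
    linarith
  have hFm : F ∈ (groupRingImage G).topologicalClosure := by
    have ha' := (groupRingImage G).le_topologicalClosure ha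
    have hc : resolventStarMul a ∈ (groupRingImage G).topologicalClosure :=
      resolventStarMul_mem (groupRingImage G).isClosed_topologicalClosure ha'
    exact (groupRingImage G).topologicalClosure.smul_mem (mul_mem ha' hc) _
  obtain ⟨b, hb, hFb⟩ := Metric.mem_closure_iff.1 hFm δ hδ
  rw [dist_eq_norm] at hFb
  have hb1 : ‖b‖ ≤ 1 + δ := by
    have := norm_sub_rev F b
    have := norm_le_norm_add_norm_sub' b F
    linarith
  have hr : ‖((1 + δ : ℝ) : ℂ)⁻¹‖ = (1 + δ)⁻¹ := by
    rw [norm_inv, Complex.norm_real, Real.norm_of_nonneg (by positivity)]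
  refine ⟨((1 + δ : ℝ) : ℂ)⁻¹ • b, (groupRingImage G).smul_mem hb _, ?_, ?_⟩
  · rw [norm_smul, hr, inv_mul_le_iff₀ (by positivity), mul_one]
    exact hb1
  · have h3 : norm₂ (b - ((1 + δ : ℝ) : ℂ)⁻¹ • b) ≤ δ := by
      have hne : ((1 + δ : ℝ) : ℂ) ≠ 0 := by exact_mod_cast (by positivity : (1 + δ : ℝ) ≠ 0)
      have e : b - ((1 + δ : ℝ) : ℂ)⁻¹ • b = (((1 + δ : ℝ) : ℂ)⁻¹ * (δ : ℂ)) • b := by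
        have : (1 : ℂ) - ((1 + δ : ℝ) : ℂ)⁻¹ = ((1 + δ : ℝ) : ℂ)⁻¹ * (δ : ℂ) := by
          field_simp
          push_cast
          ring
        rw [← this, sub_smul, one_smul]
      refine (norm₂_le _).trans ?_
      rw [e, norm_smul, norm_mul, hr, Complex.norm_real, Real.norm_of_nonneg hδ.le, mul_assoc,
        inv_mul_le_iff₀ (by positivity), mul_comm]
      exact mul_le_mul_of_nonneg_right hb1 hδ.le
    have h4 : norm₂ (F - b) < δ := (norm₂_le _).trans_lt hFb
    have h5 := norm₂_add_le (x - F) (F - b)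
    have h6 := norm₂_add_le (x - b) (b - ((1 + δ : ℝ) : ℂ)⁻¹ • b)
    rw [sub_add_sub_cancel] at h5 h6
    linarith

/-- **Kaplansky density**: the group ring elements of operator norm at most `n` are
`‖·‖₂`-dense in the operator norm ball of radius `n` of `L(G)`. -/
theorem exists_groupRingImage_norm_le {n : ℕ+} (x : Ball G n) {ε : ℝ} (hε : 0 < ε) :
    ∃ c ∈ groupRingImage G, ‖c‖ ≤ (n : ℝ) ∧ norm₂ (x.val - c) < ε := by
  have hn : (0 : ℝ) < n := by exact_mod_cast n.pos
  have hnc : ((n : ℝ) : ℂ) ≠ 0 := by exact_mod_cast hn.ne'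
  have hx1 : ‖((n : ℝ) : ℂ)⁻¹ • x.val‖ ≤ 1 := by
    rw [norm_smul, norm_inv, Complex.norm_real, Real.norm_of_nonneg hn.le, inv_mul_le_iff₀ hn,
      mul_one]
    exact x.norm_le
  obtain ⟨c, hc, hc1, hxc⟩ := exists_groupRingImage_norm_le_one
    ((groupVN G).smul_mem x.mem ((n : ℝ) : ℂ)⁻¹) hx1 (div_pos hε hn)
  refine ⟨((n : ℝ) : ℂ) • c, (groupRingImage G).smul_mem hc _, ?_, ?_⟩
  · rw [norm_smul, Complex.norm_real, Real.norm_of_nonneg hn.le]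
    exact mul_le_of_le_one_right hn.le hc1
  · have e : x.val - ((n : ℝ) : ℂ) • c =
        ((n : ℝ) : ℂ) • (((n : ℝ) : ℂ)⁻¹ • x.val - c) := by
      rw [smul_sub, smul_inv_smul₀ hnc]
    rw [e, norm₂_smul, Complex.norm_real, Real.norm_of_nonneg hn.le]
    rw [lt_div_iff₀ hn] at hxc
    linarith

end GroupVN

/-! ### Back-and-forth equivalent tuples of group elements -/

section BackAndForth

theorem BackForth.symm {L : FirstOrder.Language} {M N : Type*} [L.Structure M] [L.Structure N]
    {α : Ordinal} {n : ℕ} {a : Fin n → M} {b : Fin n → N} (h : BackForth L α a b) :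
    BackForth L α b a := by
  induction α using WellFoundedLT.induction generalizing n with
  | ind α ih =>
    rw [BackForth] at h ⊢
    refine ⟨fun h0 φ hφ => (h.1 h0 φ hφ).symm, fun β hβ => ⟨fun m c => ?_, fun m d => ?_⟩⟩
    · obtain ⟨d, hd⟩ := (h.2 β hβ).2 m c
      exact ⟨d, ih β hβ hd⟩
    · obtain ⟨c, hc⟩ := (h.2 β hβ).1 m d
      exact ⟨c, ih β hβ hc⟩

theorem BackForth.forth {L : FirstOrder.Language} {M N : Type*} [L.Structure M] [L.Structure N]
    {α β : Ordinal} {n : ℕ} {a : Fin n → M} {b : Fin n → N} (h : BackForth L α a b) (hβ : β < α)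
    {m : ℕ} (c : Fin m → M) : ∃ d : Fin m → N, BackForth L β (Fin.append a c) (Fin.append b d) := by
  rw [BackForth] at h
  exact (h.2 β hβ).1 m c

theorem BackForth.of_lt {L : FirstOrder.Language} {M N : Type*} [L.Structure M] [L.Structure N]
    {α β : Ordinal} {n : ℕ} {a : Fin n → M} {b : Fin n → N} (h : BackForth L α a b) (hβ : β < α) :
    BackForth L β a b := by
  -- The move with the empty tuple only lowers the rank.
  obtain ⟨d, hd⟩ := h.forth hβ Fin.elim0
  rw [Subsingleton.elim d Fin.elim0] at hd
  simpa [Fin.append_elim0] using hd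

theorem BackForth.of_le {L : FirstOrder.Language} {M N : Type*} [L.Structure M] [L.Structure N]
    {α β : Ordinal} {n : ℕ} {a : Fin n → M} {b : Fin n → N} (h : BackForth L α a b) (hβ : β ≤ α) :
    BackForth L β a b :=
  hβ.eq_or_lt.elim (fun e => e ▸ h) h.of_lt

variable {G H : Type*} [Group G] [Group H]

/-- The subgroup of `G × H` generated by the pairs `(aᵢ, bᵢ)`. When `a` and `b` have the same
quantifier-free type, it is the graph of the isomorphism `⟨a⟩ ≃ ⟨b⟩` taking `aᵢ` to `bᵢ`. -/
def pairSubgroup {n : ℕ} (a : Fin n → G) (b : Fin n → H) : Subgroup (G × H) :=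
  Subgroup.closure (Set.range fun i => (a i, b i))

theorem pairSubgroup_swap {n : ℕ} {a : Fin n → G} {b : Fin n → H} {p : G × H}
    (hp : p ∈ pairSubgroup a b) : p.swap ∈ pairSubgroup b a := by
  induction hp using Subgroup.closure_induction with
  | mem p hp =>
    obtain ⟨i, rfl⟩ := hp
    exact Subgroup.subset_closure ⟨i, rfl⟩
  | one => exact one_mem _
  | mul p q _ _ hp hq => exact mul_mem hp hq
  | inv p _ hp => exact inv_mem hp

theorem pairSubgroup_le_append {n m : ℕ} (a : Fin n → G) (b : Fin n → H) (c : Fin m → G)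
    (d : Fin m → H) : pairSubgroup a b ≤ pairSubgroup (Fin.append a c) (Fin.append b d) := by
  refine (Subgroup.closure_le _).2 ?_
  rintro _ ⟨i, rfl⟩
  exact Subgroup.subset_closure ⟨Fin.castAdd m i, by simp⟩

theorem mem_pairSubgroup_append {n m : ℕ} (a : Fin n → G) (b : Fin n → H) (c : Fin m → G)
    (d : Fin m → H) (i : Fin m) :
    (c i, d i) ∈ pairSubgroup (Fin.append a c) (Fin.append b d) :=
  Subgroup.subset_closure ⟨Fin.natAdd n i, by simp⟩

/-- Every element of `⟨(aᵢ, bᵢ)⟩` is the value of one group term at `a` and at `b`. -/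
theorem exists_term_of_mem_pairSubgroup {n : ℕ} {a : Fin n → G} {b : Fin n → H} {p : G × H}
    (hp : p ∈ pairSubgroup a b) :
    ∃ t : groupLanguage.Term (Fin n), t.realize a = p.1 ∧ t.realize b = p.2 := by
  induction hp using Subgroup.closure_induction with
  | mem p hp =>
    obtain ⟨i, rfl⟩ := hp
    exact ⟨.var i, rfl, rfl⟩
  | one => exact ⟨.func (l := 0) GroupFn.one Fin.elim0, rfl, rfl⟩
  | mul p q _ _ hp hq =>
    obtain ⟨s, hs₁, hs₂⟩ := hp
    obtain ⟨t, ht₁, ht₂⟩ := hq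
    refine ⟨.func (l := 2) GroupFn.mul ![s, t], ?_, ?_⟩
    · change s.realize a * t.realize a = _
      rw [hs₁, ht₁]; rfl
    · change s.realize b * t.realize b = _
      rw [hs₂, ht₂]; rfl
  | inv p _ hp =>
    obtain ⟨s, hs₁, hs₂⟩ := hp
    refine ⟨.func (l := 1) GroupFn.inv ![s], ?_, ?_⟩
    · change (s.realize a)⁻¹ = _
      rw [hs₁]; rfl
    · change (s.realize b)⁻¹ = _
      rw [hs₂]; rfl

/-- Tuples with the same quantifier-free type satisfy the same relations. -/
theorem BackForth.fst_eq_one_iff {n : ℕ} {a : Fin n → G} {b : Fin n → H} {α : Ordinal}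
    (h : BackForth groupLanguage α a b) {p : G × H} (hp : p ∈ pairSubgroup a b) :
    p.1 = 1 ↔ p.2 = 1 := by
  obtain ⟨t, ht₁, ht₂⟩ := exists_term_of_mem_pairSubgroup hp
  have h0 := h.of_le zero_le
  rw [BackForth] at h0
  let e : groupLanguage.Term (Fin n) := .func (l := 0) GroupFn.one Fin.elim0
  have := h0.1 rfl (t.equal e)
    (FirstOrder.Language.BoundedFormula.IsAtomic.equal _ _).isQF
  rw [FirstOrder.Language.Formula.realize_equal, FirstOrder.Language.Formula.realize_equal, ht₁,
    ht₂] at this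
  exact this

end BackAndForth

/-! ### Linked elements of the two group rings -/

namespace GroupVN

variable {G H : Type*} [Group G] [Group H]

/-- For a subgroup `K` of `G × H`, the algebra of all pairs `(∑ cᵢ u_{gᵢ}, ∑ cᵢ u_{hᵢ})` with
`(gᵢ, hᵢ) ∈ K`, as the image of the group ring of `K`. -/
noncomputable def linkAlgebra (K : Subgroup (G × H)) :
    Subalgebra ℂ ((EllTwo G →L[ℂ] EllTwo G) × (EllTwo H →L[ℂ] EllTwo H)) :=
  (MonoidAlgebra.lift ℂ _ K (((leftReg G).prodMap (leftReg H)).comp K.subtype)).range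

theorem of_mem_linkAlgebra {K : Subgroup (G × H)} {g : G} {h : H} (hK : (g, h) ∈ K) :
    (leftReg G g, leftReg H h) ∈ linkAlgebra K :=
  ⟨MonoidAlgebra.of ℂ K ⟨(g, h), hK⟩, by simp⟩

theorem linkAlgebra_induction {K : Subgroup (G × H)}
    {P : (EllTwo G →L[ℂ] EllTwo G) × (EllTwo H →L[ℂ] EllTwo H) → Prop}
    (of : ∀ g h, (g, h) ∈ K → P (leftReg G g, leftReg H h))
    (add : ∀ x y, P x → P y → P (x + y)) (smul : ∀ (c : ℂ) x, P x → P (c • x))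
    {x : (EllTwo G →L[ℂ] EllTwo G) × (EllTwo H →L[ℂ] EllTwo H)} (hx : x ∈ linkAlgebra K) : P x := by
  obtain ⟨f, rfl⟩ := hx
  change P (MonoidAlgebra.lift ℂ _ K _ f)
  induction f using MonoidAlgebra.induction_on with
  | of k => simpa using! of k.1.1 k.1.2 k.2
  | add f₁ f₂ h₁ h₂ => rw [map_add]; exact add _ _ h₁ h₂
  | smul c f hf => rw [map_smul]; exact smul _ _ hf

theorem star_mem_linkAlgebra {K : Subgroup (G × H)}
    {x : (EllTwo G →L[ℂ] EllTwo G) × (EllTwo H →L[ℂ] EllTwo H)} (hx : x ∈ linkAlgebra K) :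
    star x ∈ linkAlgebra K := by
  refine linkAlgebra_induction (P := fun x => star x ∈ linkAlgebra K) ?_ ?_ ?_ hx
  · intro g h hK
    rw [Prod.star_def, star_leftReg, star_leftReg]
    exact of_mem_linkAlgebra (inv_mem hK)
  · intro x y hx hy
    rw [star_add]
    exact add_mem hx hy
  · intro c x hx
    rw [star_smul]
    exact (linkAlgebra K).smul_mem hx _

theorem linkAlgebra_mono {K K' : Subgroup (G × H)} (hK : K ≤ K') :
    linkAlgebra K ≤ linkAlgebra K' := fun _ hx =>
  linkAlgebra_induction (fun _ _ h => of_mem_linkAlgebra (hK h)) (fun _ _ => add_mem)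
    (fun c _ hx => (linkAlgebra K').smul_mem hx c) hx

theorem swap_mem_linkAlgebra {n : ℕ} {a : Fin n → G} {b : Fin n → H}
    {x : (EllTwo G →L[ℂ] EllTwo G) × (EllTwo H →L[ℂ] EllTwo H)}
    (hx : x ∈ linkAlgebra (pairSubgroup a b)) : x.swap ∈ linkAlgebra (pairSubgroup b a) :=
  linkAlgebra_induction (P := fun x => x.swap ∈ linkAlgebra (pairSubgroup b a))
    (fun _ _ h => of_mem_linkAlgebra (pairSubgroup_swap h)) (fun _ _ => add_mem)
    (fun c _ hx => (linkAlgebra (pairSubgroup b a)).smul_mem hx c) hx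

theorem leftReg_mem_groupRingImage (g : G) : leftReg G g ∈ groupRingImage G :=
  ⟨MonoidAlgebra.of ℂ G g, by
    change groupRingRep G _ = _
    simp [groupRingRep]⟩

theorem snd_mem_groupRingImage {K : Subgroup (G × H)}
    {x : (EllTwo G →L[ℂ] EllTwo G) × (EllTwo H →L[ℂ] EllTwo H)} (hx : x ∈ linkAlgebra K) :
    x.2 ∈ groupRingImage H :=
  linkAlgebra_induction (P := fun x => x.2 ∈ groupRingImage H)
    (fun _ h _ => leftReg_mem_groupRingImage h) (fun _ _ => add_mem)
    (fun c _ hx => (groupRingImage H).smul_mem hx c) hx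

theorem trace_leftReg (g : G) [Decidable (g = 1)] : trace (leftReg G g) = if g = 1 then 1 else 0 := by
  classical
  rw [trace, leftReg_delta, mul_one, delta, delta, lp.inner_single_left]
  simp [lp.single_apply, Pi.single_apply, eq_comm]

theorem trace_eq_of_mem_linkAlgebra {n : ℕ} {a : Fin n → G} {b : Fin n → H} {α : Ordinal}
    (hab : BackForth groupLanguage α a b)
    {x : (EllTwo G →L[ℂ] EllTwo G) × (EllTwo H →L[ℂ] EllTwo H)}
    (hx : x ∈ linkAlgebra (pairSubgroup a b)) : trace x.1 = trace x.2 := by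
  classical
  refine linkAlgebra_induction (P := fun x => trace x.1 = trace x.2) ?_ ?_ ?_ hx
  · intro g h hK
    rw [trace_leftReg, trace_leftReg]
    simp only [hab.fst_eq_one_iff hK]
  · intro x y hx hy
    simpa [trace, inner_add_right] using! congrArg₂ (· + ·) hx hy
  · intro c x hx
    simpa [trace, inner_smul_right] using! congrArg (c * ·) hx

theorem norm₂_eq_of_mem_linkAlgebra {n : ℕ} {a : Fin n → G} {b : Fin n → H} {α : Ordinal}
    (hab : BackForth groupLanguage α a b)
    {x : (EllTwo G →L[ℂ] EllTwo G) × (EllTwo H →L[ℂ] EllTwo H)}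
    (hx : x ∈ linkAlgebra (pairSubgroup a b)) : norm₂ x.1 = norm₂ x.2 := by
  have := trace_eq_of_mem_linkAlgebra hab (mul_mem (star_mem_linkAlgebra hx) hx)
  rw [norm₂, norm₂]
  exact congrArg (fun z : ℂ => √z.re) this

/-- The forth move for group ring elements: answer the finite support. -/
theorem exists_link {α β : Ordinal} (hβ : β < α) {n : ℕ} {a : Fin n → G} {b : Fin n → H}
    (hab : BackForth groupLanguage α a b) {y : EllTwo G →L[ℂ] EllTwo G}
    (hy : y ∈ groupRingImage G) :
    ∃ (n' : ℕ) (a' : Fin n' → G) (b' : Fin n' → H), BackForth groupLanguage β a' b' ∧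
      pairSubgroup a b ≤ pairSubgroup a' b' ∧ ∃ z, (y, z) ∈ linkAlgebra (pairSubgroup a' b') := by
  obtain ⟨f, rfl⟩ := hy
  let e := f.coeff.support.equivFin
  obtain ⟨d, hd⟩ := hab.forth hβ fun i => ((e.symm i : f.coeff.support) : G)
  refine ⟨_, _, _, hd, pairSubgroup_le_append _ _ _ _,
    ∑ g : f.coeff.support, f.coeff g • leftReg H (d (e g)), ?_⟩
  have h1 : groupRingRep G f = ∑ g : f.coeff.support, f.coeff g • leftReg G g := by
    rw [groupRingRep, MonoidAlgebra.lift_apply, Finsupp.sum,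
      Finset.sum_coe_sort f.coeff.support fun g => f.coeff g • leftReg G g]
  have h2 := Subalgebra.sum_mem (linkAlgebra (pairSubgroup (Fin.append a _) (Fin.append b d)))
    (t := Finset.univ)
    (f := fun g : f.coeff.support => f.coeff g • (leftReg G g, leftReg H (d (e g))))
    fun g _ => Subalgebra.smul_mem _ (of_mem_linkAlgebra (by
      simpa using mem_pairSubgroup_append a b (fun i => ((e.symm i : f.coeff.support) : G)) d
        (e g))) _
  convert h2 using 1
  refine Prod.ext ?_ ?_
  · rw [Prod.fst_sum]
    exact h1
  · rw [Prod.snd_sum]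
    rfl

/-- Linked elements have comparable operator norms as soon as there is one more move in the
game: the norm of `z` is tested on vectors `w δ_e` with `w` in the group ring of `H`, and such a
`w` has an answer in the group ring of `G`. -/
theorem norm_snd_le_of_mem_linkAlgebra {n : ℕ} {a : Fin n → G} {b : Fin n → H} {α : Ordinal}
    (hα : 0 < α) (hab : BackForth groupLanguage α a b)
    {y : EllTwo G →L[ℂ] EllTwo G} {z : EllTwo H →L[ℂ] EllTwo H}
    (hyz : (y, z) ∈ linkAlgebra (pairSubgroup a b)) : ‖z‖ ≤ ‖y‖ := by
  have hzy : (z, y) ∈ linkAlgebra (pairSubgroup b a) := swap_mem_linkAlgebra hyz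
  have key : ∀ w ∈ groupRingImage H, ‖z (w (delta 1))‖ ≤ ‖y‖ * ‖w (delta 1)‖ := by
    intro w hw
    obtain ⟨_, b', a', hba, hle, w', hw'⟩ := exists_link hα hab.symm hw
    have hzw : (z * w, y * w') ∈ linkAlgebra (pairSubgroup b' a') :=
      (linkAlgebra _).mul_mem (linkAlgebra_mono hle hzy) hw'
    have e1 : norm₂ (z * w) = norm₂ (y * w') :=
      norm₂_eq_of_mem_linkAlgebra (x := (z * w, y * w')) hba hzw
    have e2 : norm₂ w = norm₂ w' := norm₂_eq_of_mem_linkAlgebra (x := (w, w')) hba hw'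
    have e3 := norm₂_mul_le_left y w'
    rw [← e1, ← e2, norm₂_eq, norm₂_eq] at e3
    exact e3
  -- The vectors `w δ_e` are dense, since they include all `δ_g`.
  let S : Submodule ℂ (EllTwo H) := (groupRingImage H).toSubalgebra.toSubmodule.map
    (ContinuousLinearMap.apply ℂ (EllTwo H) (delta (1 : H))).toLinearMap
  have hS : ∀ ξ, ξ ∈ S.topologicalClosure :=
    mem_of_delta_mem _ S.isClosed_topologicalClosure fun g =>
      S.le_topologicalClosure ⟨leftReg H g, leftReg_mem_groupRingImage g, by
        change leftReg H g (delta 1) = _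
        rw [leftReg_delta, mul_one]⟩
  have hcl : IsClosed {ξ : EllTwo H | ‖z ξ‖ ≤ ‖y‖ * ‖ξ‖} :=
    isClosed_le (by fun_prop) (by fun_prop)
  refine z.opNorm_le_bound (norm_nonneg _) fun ξ => ?_
  refine closure_minimal ?_ hcl (hS ξ)
  rintro _ ⟨w, hw, rfl⟩
  exact key w hw

end GroupVN

/-! ### Formulas of continuous logic are uniformly continuous -/

namespace ContLogic

variable {L : MetricLanguage}

theorem Modulus.exists_le {n : ℕ} (m : Modulus n) {ε : ℝ} (hε : 0 < ε) :
    ∃ δ : ℝ, 0 < δ ∧ ∀ x : Fin n → ℝ≥0, (∀ i, (x i : ℝ) ≤ δ) → (m.toFun x : ℝ) ≤ ε := by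
  have hc : Continuous fun x => (m.toFun x : ℝ) := NNReal.continuous_coe.comp m.cont
  obtain ⟨δ, hδ, h⟩ := Metric.continuous_iff.1 hc 0 ε hε
  refine ⟨δ / 2, by positivity, fun x hx => ?_⟩
  have hd : dist x 0 < δ := by
    refine (dist_pi_lt_iff hδ).2 fun i => ?_
    rw [NNReal.dist_eq]
    simp only [Pi.zero_apply, NNReal.coe_zero, sub_zero, NNReal.abs_eq]
    linarith [hx i]
  have := h x hd
  rw [m.map_zero, NNReal.coe_zero, Real.dist_eq, sub_zero] at this
  exact (le_abs_self _).trans this.le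

theorem exists_pos_forall_fin {n : ℕ} {P : Fin n → ℝ → Prop}
    (hP : ∀ i δ δ', δ' ≤ δ → P i δ → P i δ') (h : ∀ i, ∃ δ, 0 < δ ∧ P i δ) :
    ∃ δ, 0 < δ ∧ ∀ i, P i δ := by
  choose δ hδ hPδ using h
  obtain ⟨δ₀, h0, hle⟩ : ∃ δ₀ : ℝ, 0 < δ₀ ∧ ∀ i, δ₀ ≤ δ i := by
    have := (Filter.eventually_all.2 fun i =>
      (eventually_le_nhds (hδ i)).filter_mono nhdsWithin_le_nhds).and
        (self_mem_nhdsWithin (s := Set.Ioi (0 : ℝ)) (a := 0))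
    obtain ⟨δ₀, h1, h2⟩ := this.exists
    exact ⟨δ₀, h2, h1⟩
  exact ⟨δ₀, h0, fun i => hP i _ _ (hle i) (hPδ i)⟩

theorem Term.eval_uniform (M : MetricStructure L) {V : L.Srt → Type} {s : L.Srt} (t : Term L V s)
    {ε : ℝ} (hε : 0 < ε) : ∃ δ : ℝ, 0 < δ ∧ ∀ v w : ∀ s, V s → M.carrier s,
      (∀ s x, dist (v s x) (w s x) ≤ δ) → dist (t.eval M v) (t.eval M w) ≤ ε := by
  induction t generalizing ε with
  | var x => exact ⟨ε, hε, fun v w h => h _ x⟩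
  | app f ts ih =>
    obtain ⟨δ, hδ, hf⟩ := (L.fnMod f).exists_le hε
    obtain ⟨δ', hδ', h'⟩ := exists_pos_forall_fin
      (P := fun i δ' => ∀ v w : ∀ s, V s → M.carrier s, (∀ s x, dist (v s x) (w s x) ≤ δ') →
        dist ((ts i).eval M v) ((ts i).eval M w) ≤ δ)
      (fun i _ _ hle h v w hvw => h v w fun s x => (hvw s x).trans hle) fun i => ih i hδ
    exact ⟨δ', hδ', fun v w hvw => (M.fn_obeys f _ _).trans (hf _ fun i => h' i v w hvw)⟩

theorem dist_extend_le (M : MetricStructure L) {V : L.Srt → Type} {v w : ∀ s, V s → M.carrier s}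
    {δ : ℝ} (h : ∀ s x, dist (v s x) (w s x) ≤ δ) {s : L.Srt} {a b : M.carrier s}
    (hab : dist a b ≤ δ) (t : L.Srt) (x : Ext V s t) :
    dist (extend M v a t x) (extend M w b t x) ≤ δ := by
  cases x with
  | old x => exact h _ x
  | new => exact hab

/-- Suprema and infima of bounded functions agree up to `ε` when each value of one function is
within `ε` of some value of the other. -/
theorem abs_iSup_sub_iSup_le {ι κ : Type*} [Nonempty ι] [Nonempty κ] {f : ι → ℝ} {g : κ → ℝ}
    {ε : ℝ} (hf : BddAbove (Set.range f)) (hg : BddAbove (Set.range g))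
    (hfg : ∀ i, ∃ j, |f i - g j| ≤ ε) (hgf : ∀ j, ∃ i, |f i - g j| ≤ ε) :
    |(⨆ i, f i) - ⨆ j, g j| ≤ ε := by
  have h1 : (⨆ i, f i) ≤ (⨆ j, g j) + ε := ciSup_le fun i => by
    obtain ⟨j, hj⟩ := hfg i
    linarith [(abs_le.1 hj).2, le_ciSup hg j]
  have h2 : (⨆ j, g j) ≤ (⨆ i, f i) + ε := ciSup_le fun j => by
    obtain ⟨i, hi⟩ := hgf j
    linarith [(abs_le.1 hi).1, le_ciSup hf i]
  exact abs_le.2 ⟨by linarith, by linarith⟩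

theorem abs_iInf_sub_iInf_le {ι κ : Type*} [Nonempty ι] [Nonempty κ] {f : ι → ℝ} {g : κ → ℝ}
    {ε : ℝ} (hf : BddBelow (Set.range f)) (hg : BddBelow (Set.range g))
    (hfg : ∀ i, ∃ j, |f i - g j| ≤ ε) (hgf : ∀ j, ∃ i, |f i - g j| ≤ ε) :
    |(⨅ i, f i) - ⨅ j, g j| ≤ ε := by
  have h1 : (⨅ j, g j) - ε ≤ ⨅ i, f i := le_ciInf fun i => by
    obtain ⟨j, hj⟩ := hfg i
    linarith [(abs_le.1 hj).1, ciInf_le hg j]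
  have h2 : (⨅ i, f i) - ε ≤ ⨅ j, g j := le_ciInf fun j => by
    obtain ⟨i, hi⟩ := hgf j
    linarith [(abs_le.1 hi).2, ciInf_le hf i]
  exact abs_le.2 ⟨by linarith, by linarith⟩

theorem Formula.bddAbove_eval (M : MetricStructure L) {V : L.Srt → Type} {s : L.Srt}
    (φ : Formula L (Ext V s)) (v : ∀ s, V s → M.carrier s) :
    BddAbove (Set.range fun a => φ.eval M (extend M v a)) := by
  obtain ⟨C, hC⟩ := φ.eval_bounded M
  exact ⟨C, by rintro _ ⟨a, rfl⟩; exact (abs_le.1 (hC _)).2⟩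

theorem Formula.bddBelow_eval (M : MetricStructure L) {V : L.Srt → Type} {s : L.Srt}
    (φ : Formula L (Ext V s)) (v : ∀ s, V s → M.carrier s) :
    BddBelow (Set.range fun a => φ.eval M (extend M v a)) := by
  obtain ⟨C, hC⟩ := φ.eval_bounded M
  exact ⟨-C, by rintro _ ⟨a, rfl⟩; exact (abs_le.1 (hC _)).1⟩

theorem Formula.eval_uniform (M : MetricStructure L) {V : L.Srt → Type} (φ : Formula L V)
    {ε : ℝ} (hε : 0 < ε) : ∃ δ : ℝ, 0 < δ ∧ ∀ v w : ∀ s, V s → M.carrier s,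
      (∀ s x, Dist.dist (v s x) (w s x) ≤ δ) → |φ.eval M v - φ.eval M w| ≤ ε := by
  induction φ generalizing ε with
  | dist t₁ t₂ =>
    obtain ⟨δ₁, h₁, H₁⟩ := t₁.eval_uniform M (half_pos hε)
    obtain ⟨δ₂, h₂, H₂⟩ := t₂.eval_uniform M (half_pos hε)
    refine ⟨min δ₁ δ₂, lt_min h₁ h₂, fun v w h => ?_⟩
    have e₁ := H₁ v w fun s x => (h s x).trans (min_le_left _ _)
    have e₂ := H₂ v w fun s x => (h s x).trans (min_le_right _ _)
    have := dist_dist_dist_le (t₁.eval M v) (t₂.eval M v) (t₁.eval M w) (t₂.eval M w)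
    rw [Real.dist_eq] at this
    rw [Formula.eval, Formula.eval]
    linarith
  | @pred V P ts =>
    obtain ⟨δ, hδ, hf⟩ := (L.prMod P).exists_le hε
    obtain ⟨δ', hδ', h'⟩ := exists_pos_forall_fin
      (P := fun i δ' => ∀ v w : ∀ s, V s → M.carrier s, (∀ s x, Dist.dist (v s x) (w s x) ≤ δ') →
        Dist.dist ((ts i).eval M v) ((ts i).eval M w) ≤ δ)
      (fun i _ _ hle h v w hvw => h v w fun s x => (hvw s x).trans hle)
      fun i => (ts i).eval_uniform M hδ
    exact ⟨δ', hδ', fun v w hvw => (M.pr_obeys P _ _).trans (hf _ fun i => h' i v w hvw)⟩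
  | @conn V n u φ ih =>
    -- A connective is uniformly continuous on the compact box of values of its arguments.
    choose C hC using fun i => (φ i).eval_bounded M
    have hu := (isCompact_univ_pi fun i =>
      isCompact_Icc (a := -C i) (b := C i)).uniformContinuousOn_of_continuous
        u.continuous.continuousOn
    obtain ⟨δ, hδ, hδu⟩ := Metric.uniformContinuousOn_iff_le.1 hu ε hε
    obtain ⟨δ', hδ', h'⟩ := exists_pos_forall_fin
      (P := fun i δ' => ∀ v w : ∀ s, V s → M.carrier s, (∀ s x, Dist.dist (v s x) (w s x) ≤ δ') →
        |(φ i).eval M v - (φ i).eval M w| ≤ δ)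
      (fun i _ _ hle h v w hvw => h v w fun s x => (hvw s x).trans hle)
      fun i => ih i hδ
    refine ⟨δ', hδ', fun v w hvw => ?_⟩
    rw [Formula.eval, Formula.eval, ← Real.dist_eq]
    exact hδu _ (fun i _ => abs_le.1 (hC i v)) _ (fun i _ => abs_le.1 (hC i w))
      ((dist_pi_le_iff hδ.le).2 fun i => h' i v w hvw)
  | sup s φ ih =>
    obtain ⟨δ, hδ, h⟩ := ih hε
    refine ⟨δ, hδ, fun v w hvw => ?_⟩
    have hd := fun a => h _ _
      (dist_extend_le M hvw (s := s) (a := a) (b := a) ((dist_self a).trans_le hδ.le))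
    exact abs_iSup_sub_iSup_le (φ.bddAbove_eval M v) (φ.bddAbove_eval M w)
      (fun a => ⟨a, hd a⟩) fun a => ⟨a, hd a⟩
  | inf s φ ih =>
    obtain ⟨δ, hδ, h⟩ := ih hε
    refine ⟨δ, hδ, fun v w hvw => ?_⟩
    have hd := fun a => h _ _
      (dist_extend_le M hvw (s := s) (a := a) (b := a) ((dist_self a).trans_le hδ.le))
    exact abs_iInf_sub_iInf_le (φ.bddBelow_eval M v) (φ.bddBelow_eval M w)
      (fun a => ⟨a, hd a⟩) fun a => ⟨a, hd a⟩

end ContLogic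

/-! ### The game between the two von Neumann algebras -/

namespace GroupVN

open ContLogic

variable {G H : Type*} [Group G] [Group H]

/-- An element of the sort `s` of `L(G)` and one of the same sort of `L(H)` are linked by
`K ≤ G × H` when they are given by the same element of the group ring of `K`. -/
def Linked (K : Subgroup (G × H)) (s : ℕ+) (x : Ball G s) (y : Ball H s) : Prop :=
  (x.val, y.val) ∈ linkAlgebra K

/-- Assignments `v` in `L(G)` and `w` in `L(H)` are related at rank `α` when corresponding values
are linked by the pairs `(aᵢ, bᵢ)` for tuples `a`, `b` which are back-and-forth equivalent at
rank `α`. -/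
def AssignRel (α : Ordinal.{0}) {V : tracialLanguage.Srt → Type}
    (v : ∀ s, V s → (groupVNStructure G).carrier s)
    (w : ∀ s, V s → (groupVNStructure H).carrier s) : Prop :=
  ∃ (n : ℕ) (a : Fin n → G) (b : Fin n → H), BackForth groupLanguage α a b ∧
    ∀ s x, Linked (pairSubgroup a b) s (v s x) (w s x)

theorem AssignRel.of_le {α β : Ordinal.{0}} (hβ : β ≤ α) {V : tracialLanguage.Srt → Type}
    {v : ∀ s, V s → (groupVNStructure G).carrier s}
    {w : ∀ s, V s → (groupVNStructure H).carrier s} (h : AssignRel α v w) : AssignRel β v w := by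
  obtain ⟨n, a, b, hab, hvw⟩ := h
  exact ⟨n, a, b, hab.of_le hβ, hvw⟩

theorem AssignRel.symm {α : Ordinal.{0}} {V : tracialLanguage.Srt → Type}
    {v : ∀ s, V s → (groupVNStructure G).carrier s}
    {w : ∀ s, V s → (groupVNStructure H).carrier s} (h : AssignRel α v w) : AssignRel α w v := by
  obtain ⟨n, a, b, hab, hvw⟩ := h
  exact ⟨n, b, a, hab.symm, fun s x => swap_mem_linkAlgebra (hvw s x)⟩

theorem Linked.add {K : Subgroup (G × H)} {m n : ℕ+} {x : Ball G m} {y : Ball H m} {x' : Ball G n}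
    {y' : Ball H n} (h : Linked K m x y) (h' : Linked K n x' y') :
    Linked K (m + n) (ballAdd m n x x') (ballAdd m n y y') :=
  (linkAlgebra K).add_mem h h'

theorem Linked.mul {K : Subgroup (G × H)} {m n : ℕ+} {x : Ball G m} {y : Ball H m} {x' : Ball G n}
    {y' : Ball H n} (h : Linked K m x y) (h' : Linked K n x' y') :
    Linked K (m * n) (ballMul m n x x') (ballMul m n y y') :=
  (linkAlgebra K).mul_mem h h'

theorem Linked.smul {K : Subgroup (G × H)} (c : ℂ) {m n : ℕ+} (hc : ‖c‖ * (m : ℝ) ≤ (n : ℝ))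
    {x : Ball G m} {y : Ball H m} (h : Linked K m x y) :
    Linked K n (ballSMul c m n hc x) (ballSMul c m n hc y) :=
  (linkAlgebra K).smul_mem h c

theorem Linked.star {K : Subgroup (G × H)} {n : ℕ+} {x : Ball G n} {y : Ball H n}
    (h : Linked K n x y) : Linked K n (ballStar n x) (ballStar n y) :=
  star_mem_linkAlgebra (x := (x.val, y.val)) h

theorem Linked.dist_eq {α : Ordinal} {k : ℕ} {a : Fin k → G} {b : Fin k → H}
    (hab : BackForth groupLanguage α a b) {n : ℕ+} {x x' : Ball G n} {y y' : Ball H n}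
    (h : Linked (pairSubgroup a b) n x y) (h' : Linked (pairSubgroup a b) n x' y') :
    dist x x' = dist y y' :=
  norm₂_eq_of_mem_linkAlgebra (x := (x.val - x'.val, y.val - y'.val)) hab
    ((linkAlgebra _).sub_mem h h')

theorem Linked.trace_eq {α : Ordinal} {k : ℕ} {a : Fin k → G} {b : Fin k → H}
    (hab : BackForth groupLanguage α a b) {n : ℕ+} {x : Ball G n} {y : Ball H n}
    (h : Linked (pairSubgroup a b) n x y) : trace x.val = trace y.val :=
  trace_eq_of_mem_linkAlgebra (x := (x.val, y.val)) hab h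

theorem Linked.term_eval {K : Subgroup (G × H)} {V : tracialLanguage.Srt → Type}
    {v : ∀ s, V s → (groupVNStructure G).carrier s}
    {w : ∀ s, V s → (groupVNStructure H).carrier s} (h : ∀ s x, Linked K s (v s x) (w s x))
    {s : tracialLanguage.Srt} (t : Term tracialLanguage V s) :
    Linked K s (t.eval (groupVNStructure G) v) (t.eval (groupVNStructure H) w) := by
  induction t with
  | var x => exact h _ x
  | app f ts ih =>
    cases f with
    | zero => exact zero_mem (linkAlgebra K)
    | one => exact one_mem (linkAlgebra K)
    | incl m n h => exact ih (0 : Fin 1)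
    | add m n => exact Linked.add (ih (0 : Fin 2)) (ih (1 : Fin 2))
    | smul c m n h => exact Linked.smul c h (ih (0 : Fin 1))
    | mul m n => exact Linked.mul (ih (0 : Fin 2)) (ih (1 : Fin 2))
    | star n => exact Linked.star (ih (0 : Fin 1))

/-- The forth move for balls: Kaplansky density replaces the given element by one of the group
ring, and the answer in the group ring of `H` stays in the ball of the same radius. -/
theorem AssignRel.exists_extend {α β : Ordinal.{0}} (hβ : 0 < β) (hα : β < α)
    {V : tracialLanguage.Srt → Type}
    {v : ∀ s, V s → (groupVNStructure G).carrier s}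
    {w : ∀ s, V s → (groupVNStructure H).carrier s} (h : AssignRel α v w)
    {s : tracialLanguage.Srt} (x : (groupVNStructure G).carrier s) {ε : ℝ} (hε : 0 < ε) :
    ∃ (y : (groupVNStructure G).carrier s) (z : (groupVNStructure H).carrier s),
      dist x y ≤ ε ∧ AssignRel β (extend (groupVNStructure G) v y)
        (extend (groupVNStructure H) w z) := by
  obtain ⟨n, a, b, hab, hvw⟩ := h
  obtain ⟨y, hy, hyn, hxy⟩ := exists_groupRingImage_norm_le (n := s) x hε
  obtain ⟨n', a', b', hab', hle, z, hyz⟩ := exists_link hα hab hy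
  have hzn : ‖z‖ ≤ ‖y‖ := norm_snd_le_of_mem_linkAlgebra hβ hab' hyz
  refine ⟨(⟨y, groupRingImage_le_groupVN hy, hyn⟩ : Ball G s),
    (⟨z, groupRingImage_le_groupVN (snd_mem_groupRingImage hyz), hzn.trans hyn⟩ : Ball H s),
    hxy.le, n', a', b', hab', fun t u => ?_⟩
  cases u with
  | old u => exact linkAlgebra_mono hle (hvw _ u)
  | new => exact hyz

theorem AssignRel.exists_abs_eval_sub_le {k : ℕ} {V : tracialLanguage.Srt → Type}
    {v : ∀ s, V s → (groupVNStructure G).carrier s}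
    {w : ∀ s, V s → (groupVNStructure H).carrier s} (h : AssignRel (k + 2 : ℕ) v w)
    {s : tracialLanguage.Srt} (φ : Formula tracialLanguage (Ext V s))
    (hφ : ∀ v w, AssignRel k v w →
      φ.eval (groupVNStructure G) v = φ.eval (groupVNStructure H) w)
    {ε : ℝ} (hε : 0 < ε) (x : (groupVNStructure G).carrier s) :
    ∃ z : (groupVNStructure H).carrier s,
      |φ.eval (groupVNStructure G) (extend (groupVNStructure G) v x) -
        φ.eval (groupVNStructure H) (extend (groupVNStructure H) w z)| ≤ ε := by
  obtain ⟨δ, hδ, hunif⟩ := φ.eval_uniform (groupVNStructure G) hε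
  obtain ⟨y, z, hxy, hyz⟩ := h.exists_extend (β := (k + 1 : ℕ))
    (by exact_mod_cast k.succ_pos) (by exact_mod_cast Nat.lt_succ_self _) x hδ
  refine ⟨z, ?_⟩
  rw [← hφ _ _ (hyz.of_le (by exact_mod_cast Nat.le_succ k))]
  exact hunif _ _ (dist_extend_le _ (fun _ _ => (dist_self _).trans_le hδ.le) hxy)

/-- Each formula is preserved by `AssignRel k` for some finite `k`; a quantifier costs two moves,
one for the answer and one to bound the operator norm of the answer. -/
theorem exists_rank_eval_eq {V : tracialLanguage.Srt → Type} (φ : Formula tracialLanguage V) :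
    ∃ k : ℕ, ∀ (v : ∀ s, V s → (groupVNStructure G).carrier s)
      (w : ∀ s, V s → (groupVNStructure H).carrier s), AssignRel k v w →
        φ.eval (groupVNStructure G) v = φ.eval (groupVNStructure H) w := by
  induction φ with
  | dist t₁ t₂ =>
    refine ⟨0, fun v w ⟨n, a, b, hab, hvw⟩ => ?_⟩
    exact Linked.dist_eq hab (Linked.term_eval hvw t₁) (Linked.term_eval hvw t₂)
  | pred P ts =>
    refine ⟨0, fun v w ⟨n, a, b, hab, hvw⟩ => ?_⟩
    cases P with
    | trRe n =>
      exact congrArg Complex.re (Linked.trace_eq hab (Linked.term_eval hvw (ts (0 : Fin 1))))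
    | trIm n =>
      exact congrArg Complex.im (Linked.trace_eq hab (Linked.term_eval hvw (ts (0 : Fin 1))))
  | conn u φ ih =>
    choose k hk using ih
    refine ⟨Finset.univ.sup k, fun v w h => ?_⟩
    rw [Formula.eval, Formula.eval]
    congr 1
    ext i
    exact hk i v w (h.of_le (by exact_mod_cast Finset.le_sup (Finset.mem_univ i)))
  | sup s φ ih =>
    obtain ⟨k, hk⟩ := ih
    refine ⟨k + 2, fun v w h => ?_⟩
    refine eq_of_abs_sub_le_all fun ε hε => ?_
    refine abs_iSup_sub_iSup_le (φ.bddAbove_eval _ v) (φ.bddAbove_eval _ w)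
      (h.exists_abs_eval_sub_le φ hk hε) fun z => ?_
    obtain ⟨x, hx⟩ := h.symm.exists_abs_eval_sub_le φ (fun v w h => (hk w v h.symm).symm) hε z
    exact ⟨x, by rwa [abs_sub_comm]⟩
  | inf s φ ih =>
    obtain ⟨k, hk⟩ := ih
    refine ⟨k + 2, fun v w h => ?_⟩
    refine eq_of_abs_sub_le_all fun ε hε => ?_
    refine abs_iInf_sub_iInf_le (φ.bddBelow_eval _ v) (φ.bddBelow_eval _ w)
      (h.exists_abs_eval_sub_le φ hk hε) fun z => ?_
    obtain ⟨x, hx⟩ := h.symm.exists_abs_eval_sub_le φ (fun v w h => (hk w v h.symm).symm) hε z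
    exact ⟨x, by rwa [abs_sub_comm]⟩

end GroupVN

theorem mainTheorem2 {G : Type*} {H : Type*} [Group G] [Group H]
    (h : BackForthEquiv groupLanguage Ordinal.omega0.{0} G H) :
    ContLogic.ElemEquiv (GroupVN.groupVNStructure G) (GroupVN.groupVNStructure H) := by
  intro σ
  obtain ⟨k, hk⟩ := GroupVN.exists_rank_eval_eq (G := G) (H := H) σ
  exact hk _ _ ⟨0, _, _, BackForth.of_lt h (Ordinal.natCast_lt_omega0 k), fun _ x => x.elim⟩
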